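/- Let $n_r\ge n_t\ge 2$, let $\mathbf P$ be a random complex $n_r\times n_t$ matrix, let $\boldsymbol\Sigma_t$ be a deterministic positive definite Hermitian $n_t\times n_t$ matrix, put $\mathbf H=\mathbf P\sqrt{\boldsymbol\Sigma_t}$, and let $\delta>0$. Assume that $\mathbf P$ is an invariant polynomial ensemble, that is: there are real monic polynomials $p_0,\dots,p_{n_t-1}$ with $\deg p_j=j$ and real functions $q_0,\dots,q_{n_t-1}$ on $(0,\infty)$ such that every $p_aq_b$ is integrable on $(0,\infty)$ and $\int_0^\infty p_a(\lambda)q_b(\lambda)\,d\lambda=\delta_{ab}$ (Kronecker delta), and $\mathbf P^\dagger\mathbf P$ has the law of $\mathbf U^\dagger\operatorname{diag}(\lambda_1,\dots,\lambda_{n_t})\mathbf U$, where $\mathbf U$ is Haar distributed on the unitary group $\mathcal U(n_t)$, independent of $(\lambda_1,\dots,\lambda_{n_t})$, and $(\lambda_1,\dots,\lambda_{n_t})$ has on $(0,\infty)^{n_t}$ the probability density $$\frac1{n_t!}\prod_{1\le\ell<k\le n_t}(\lambda_k-\lambda_\ell)\,\det[q_{b-1}(\lambda_a)]_{a,b=1}^{n_t}.$$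 Let $K(x,y)=\sum_{j=0}^{n_t-1}p_j(x)q_j(y)$, let $\sigma_k=(\boldsymbol\Sigma_t^{-1})_{kk}$, and let $\gamma_k=\delta/[(\mathbf H^\dagger\mathbf H)^{-1}]_{kk}$ be the output SINR of the $k$-th stream of the zero-forcing receiver. Then, for every $k$, the law of $\gamma_k$ is absolutely continuous, is carried by $(0,\infty)$, and has there the density $$\rho_k(\gamma)=(n_t-1)\frac{\sigma_k}{\delta}\int_0^1K\Bigl(0,\frac{\sigma_k\gamma x}{\delta}\Bigr)(1-x)^{n_t-2}x\,dx .$$ Moreover $\ln(1+\gamma_k)$ is integrable for every $k$, and the ergodic sum rate $R=\sum_{k=1}^{n_t}\mathbb E[\ln(1+\gamma_k)]$ is $$R=(n_t-1)!\int_0^\infty K(0,x)\sum_{k=1}^{n_t}G^{2,2}_{3,3}\left(\left.\begin{array}{c}1,1;n_t\\1,1;0\end{array}\right|\frac{\delta}{\sigma_k}x\right)dx,$$ where the integral converges absolutely and, for $z>0$ and any $r\in(0,1)$, the Meijer G-function is the absolutely convergent integral $$G^{2,2}_{3,3}\left(\left.\begin{array}{c}1,1;n_t\\1,1;0\end{array}\right|z\right)=\frac1{2\pi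 i}\int_{r-i\infty}^{r+i\infty}\frac{\Gamma(1-s)^2\,\Gamma(s)^2}{\Gamma(n_t-s)\,\Gamma(1+s)}\,z^s\,ds .$$ -/

import Mathlib

open MeasureTheory Set
open scoped Matrix MatrixOrder ComplexOrder

/-- Complex matrices carry the product sigma-algebra of their entries. -/
noncomputable instance instMeasurableSpaceComplexMatrix (m n : ℕ) :
    MeasurableSpace (Matrix (Fin m) (Fin n) ℂ) :=
  inferInstanceAs (MeasurableSpace (Fin m → Fin n → ℂ))

/-- The product sigma-algebra on complex matrices is the Borel sigma-algebra. -/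
instance instBorelSpaceComplexMatrix (m n : ℕ) :
    BorelSpace (Matrix (Fin m) (Fin n) ℂ) :=
  inferInstanceAs (BorelSpace (Fin m → Fin n → ℂ))

/-- The unitary group is compact: it is closed and its entries are bounded by one. -/
instance instCompactSpaceUnitaryGroup (n : ℕ) :
    CompactSpace (Matrix.unitaryGroup (Fin n) ℂ) := by
  have hclosed : IsClosed ((Matrix.unitaryGroup (Fin n) ℂ : Set (Matrix (Fin n) (Fin n) ℂ))) := by
    have h : (Matrix.unitaryGroup (Fin n) ℂ : Set (Matrix (Fin n) (Fin n) ℂ))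
        = {A | star A * A = 1} := by
      ext A
      exact Matrix.mem_unitaryGroup_iff'
    rw [h]
    exact isClosed_eq (by fun_prop) continuous_const
  have hK : IsCompact (Set.pi Set.univ (fun _ : Fin n =>
      Set.pi Set.univ (fun _ : Fin n => Metric.closedBall (0 : ℂ) 1))) :=
    isCompact_univ_pi fun _ => isCompact_univ_pi fun _ => isCompact_closedBall 0 1
  refine isCompact_iff_compactSpace.mp (hK.of_isClosed_subset hclosed ?_)
  intro A hA i _ j _
  have h1 := entry_norm_bound_of_unitary hA i j
  simpa using h1

/-- Haar probability measure on the unitary group `U(n)`. -/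
noncomputable def haarUnitary (n : ℕ) : Measure (Matrix.unitaryGroup (Fin n) ℂ) :=
  Measure.haarMeasure ⊤

/-- The function
`p(Λ) = (1/n!) ∏_{k > l} (λ_k - λ_l) det[q_b(λ_a)]_{a,b}` (with `b = 0, …, n-1`). -/
noncomputable def eigenvalueDensity {n : ℕ} (q : Fin n → ℝ → ℝ) (lam : Fin n → ℝ) : ℝ :=
  (1 / (n.factorial : ℝ)) * (∏ l : Fin n, ∏ k ∈ Finset.Ioi l, (lam k - lam l)) *
    (Matrix.of fun a b : Fin n => q b (lam a)).det

/-- The open positive orthant, in which the eigenvalues live. -/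
def positiveOrthant (n : ℕ) : Set (Fin n → ℝ) := {lam | ∀ i, 0 < lam i}

/-- The joint law of the (unordered) eigenvalues: density `eigenvalueDensity q` with respect to
Lebesgue measure on the positive orthant. -/
noncomputable def eigenvalueLaw {n : ℕ} (q : Fin n → ℝ → ℝ) : Measure (Fin n → ℝ) :=
  (volume.restrict (positiveOrthant n)).withDensity
    fun lam => ENNReal.ofReal (eigenvalueDensity q lam)

/-- The matrix `U† diag(λ) U`. -/
noncomputable def conjugateDiagonal {n : ℕ}
    (x : Matrix.unitaryGroup (Fin n) ℂ × (Fin n → ℝ)) : Matrix (Fin n) (Fin n) ℂ :=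
  (x.1 : Matrix (Fin n) (Fin n) ℂ)ᴴ * Matrix.diagonal (fun i => ((x.2 i : ℝ) : ℂ)) *
    (x.1 : Matrix (Fin n) (Fin n) ℂ)

/-- The random `m × n` matrix `P` is an invariant polynomial ensemble with monic polynomials
`p_0, …, p_{n-1}` and biorthonormal weights `q_0, …, q_{n-1}`: the matrix `P†P` is distributed
as `U† diag(λ) U` with `U` Haar distributed, independent of `λ`, and `λ` having the
joint density `eigenvalueDensity q` on the positive orthant. -/
structure IsInvariantPolynomialEnsemble {Ω : Type*} [MeasurableSpace Ω] (μ : Measure Ω)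
    {m n : ℕ} (P : Ω → Matrix (Fin m) (Fin n) ℂ)
    (p : Fin n → Polynomial ℝ) (q : Fin n → ℝ → ℝ) : Prop where
  aemeasurable : AEMeasurable P μ
  monic : ∀ j, (p j).Monic
  natDegree_eq : ∀ j, (p j).natDegree = (j : ℕ)
  integrable : ∀ a b, IntegrableOn (fun x => (p a).eval x * q b x) (Ioi 0)
  biorthonormal : ∀ a b, ∫ x in Ioi (0 : ℝ), (p a).eval x * q b x = if a = b then 1 else 0
  density_nonneg : ∀ᵐ lam ∂(volume.restrict (positiveOrthant n)), 0 ≤ eigenvalueDensity q lam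
  law : μ.map (fun ω => (P ω)ᴴ * P ω) =
    ((haarUnitary n).prod (eigenvalueLaw q)).map conjugateDiagonal

/-- The kernel `K(x, y) = ∑_j p_j(x) q_j(y)`. -/
noncomputable def polyKernel {n : ℕ} (p : Fin n → Polynomial ℝ) (q : Fin n → ℝ → ℝ)
    (x y : ℝ) : ℝ :=
  ∑ j : Fin n, (p j).eval x * q j y

/-- Output SINR of the `k`-th stream of the zero-forcing receiver:
`δ / [(H†H)⁻¹]_{kk}` (the diagonal of the Hermitian matrix `(H†H)⁻¹` is real). -/
noncomputable def zfSINR {m n : ℕ} (δ : ℝ) (H : Matrix (Fin m) (Fin n) ℂ) (k : Fin n) : ℝ :=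
  δ / (((Hᴴ * H)⁻¹) k k).re

/-- The ergodic sum rate `∑_k E[ln(1 + γ_k)]`. -/
noncomputable def sumRate {Ω : Type*} [MeasurableSpace Ω] (μ : Measure Ω) {n : ℕ}
    (γ : Fin n → Ω → ℝ) : ℝ :=
  ∑ k : Fin n, ∫ ω, Real.log (1 + γ k ω) ∂μ

/-- `σ_k = (Σ⁻¹)_{kk}` (real, since `Σ` is Hermitian). -/
noncomputable def invDiag {n : ℕ} (S : Matrix (Fin n) (Fin n) ℂ) (k : Fin n) : ℝ :=
  (S⁻¹ k k).re

/-- The Mellin-Barnes integrand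
`∏ Γ(c_j - s) ∏ Γ(1 - a_j + s) / (∏ Γ(b_j - s) ∏ Γ(1 - d_j + s)) x^s`. -/
noncomputable def meijerIntegrand (a b c d : List ℂ) (x s : ℂ) : ℂ :=
  ((c.map fun cj => Complex.Gamma (cj - s)).prod *
      (a.map fun aj => Complex.Gamma (1 - aj + s)).prod) /
    ((b.map fun bj => Complex.Gamma (bj - s)).prod *
      (d.map fun dj => Complex.Gamma (1 - dj + s)).prod) * x ^ s

/-- The vertical line `Re s = r` is an admissible contour: every pole `c_j + ℕ` of `Γ(c_j - s)`
lies to its right and every pole `a_j - 1 - ℕ` of `Γ(1 - a_j + s)` to its left. -/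
def IsMeijerAbscissa (a c : List ℂ) (r : ℝ) : Prop :=
  (∀ cj ∈ c, r < cj.re) ∧ ∀ aj ∈ a, aj.re - 1 < r

/-- The Meijer G-function `G(a; b | c; d | x)`, as the integral
`∫ ds / (2πi)` of `meijerIntegrand a b c d x` along the line `Re s = r`,
oriented from `r - i∞` to `r + i∞` (with `s = r + it`, `ds = i dt`).
To be used for `r` with `IsMeijerAbscissa a c r`. -/
noncomputable def meijerG (r : ℝ) (a b c d : List ℂ) (x : ℂ) : ℂ :=
  (1 / (2 * (Real.pi : ℂ))) * ∫ t : ℝ, meijerIntegrand a b c d x ((r : ℂ) + (t : ℂ) * Complex.I)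

/-- The claimed density
`(n-1) (σ/δ) ∫_0^1 K(0, σγx/δ) (1-x)^{n-2} x dx` of the zero-forcing SINR. -/
noncomputable def zfDensity (n : ℕ) (K : ℝ → ℝ → ℝ) (σ δ γ : ℝ) : ℝ :=
  ((n : ℝ) - 1) * (σ / δ) * ∫ x in (0 : ℝ)..1, K 0 (σ * γ * x / δ) * (1 - x) ^ (n - 2) * x

/-
By unitary invariance `δ / γ_k` has the law of `∑ i, λ_i⁻¹ |(U v)_i|²`, where `‖v‖² = σ_k`.
Integrating a Gaussian over the unitary group and over `ℂⁿ` in the two possible orders gives, for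
`b_i > 0`, `∫ (‖v‖² / ∑ i, b_i |(U v)_i|²) ^ n dU = ∏ i, b_i⁻¹`, hence, conditionally on the `λ_i`,
`E (γ_k / (γ_k + s)) ^ n = ∏ i, λ_i / (λ_i + c s)` with `c = σ_k / δ`. Averaging the product over
the polynomial ensemble, by Andréief's identity, row operations on the resulting moment matrix and
Cramer's rule, gives `∫ K(0, y) y / (y + c s) dy`. A beta integral shows that the density `ρ_k` has
the same transform.

The transform determines a finite measure on `(0, ∞)`. As the sign of `ρ_k` is not known beforehand,
this is applied to `law(γ_k) + ρ_k⁻ dγ` and `ρ_k⁺ dγ`, and the nonnegativity of `ρ_k` comes out as a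
by-product. Finally, `E ln (1 + γ_k)` is the integral of `K(0, y)` against a beta average of
`ln (1 + y / (c x))`, and Mellin inversion, starting from `Γ(s) Γ(1 - s) = π / sin (π s)`,
identifies this average with the Meijer G-function.
-/

instance isHaarMeasure_haarUnitary (n : ℕ) : (haarUnitary n).IsHaarMeasure := by
  unfold haarUnitary
  infer_instance

instance isProbabilityMeasure_haarUnitary (n : ℕ) : IsProbabilityMeasure (haarUnitary n) :=
  ⟨by simpa [haarUnitary] using
    Measure.haarMeasure_self (K₀ := (⊤ : TopologicalSpace.PositiveCompacts
      (Matrix.unitaryGroup (Fin n) ℂ)))⟩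

instance isMulRightInvariant_haarUnitary (n : ℕ) : (haarUnitary n).IsMulRightInvariant where
  map_mul_right_eq_self g := by
    have : IsProbabilityMeasure ((haarUnitary n).map (· * g)) :=
      Measure.isProbabilityMeasure_map (measurable_mul_const g).aemeasurable
    exact Measure.isHaarMeasure_eq_of_isProbabilityMeasure _ _

section UnitaryVectors

variable {ι : Type*} [Fintype ι] [DecidableEq ι]

lemma norm_unitary_mulVec (U : Matrix.unitaryGroup ι ℂ) (v : ι → ℂ) :
    ‖WithLp.toLp 2 ((U : Matrix ι ι ℂ) *ᵥ v)‖ = ‖WithLp.toLp 2 v‖ :=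
  ContinuousLinearMap.norm_map_of_mem_unitary
    (Unitary.map_mem (Matrix.toEuclideanCLM (n := ι) (𝕜 := ℂ)) U.2) (WithLp.toLp 2 v)

lemma unitary_mulVec_ne_zero (U : Matrix.unitaryGroup ι ℂ) {v : ι → ℂ} (hv : v ≠ 0) :
    (U : Matrix ι ι ℂ) *ᵥ v ≠ 0 := fun h =>
  hv (by simpa [h] using (norm_unitary_mulVec U v).symm)

lemma exists_unitary_mulVec_single_eq (i : ι) {v : ι → ℂ} (hv : ‖WithLp.toLp 2 v‖ = 1) :
    ∃ U : Matrix.unitaryGroup ι ℂ, (U : Matrix ι ι ℂ) *ᵥ Pi.single i 1 = v := by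
  have orthonormal_const : Orthonormal ℂ (({i} : Set ι).domRestrict
      fun _ : ι => (WithLp.toLp 2 v : EuclideanSpace ℂ ι)) :=
    ⟨fun _ => hv, fun j k hjk => absurd (Subtype.ext (j.2.trans k.2.symm)) hjk⟩
  obtain ⟨b, hb⟩ := orthonormal_const.exists_orthonormalBasis_extension_of_card_eq (by simp)
  refine ⟨⟨_, (EuclideanSpace.basisFun ι ℂ).toMatrix_orthonormalBasis_mem_unitary b⟩, ?_⟩
  ext j
  rw [Matrix.mulVec_single_one]
  simp [Module.Basis.toMatrix, hb i rfl]

lemma exists_unitary_mulVec_eq_of_norm_eq {v w : ι → ℂ}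
    (h : ‖WithLp.toLp 2 v‖ = ‖WithLp.toLp 2 w‖) :
    ∃ U : Matrix.unitaryGroup ι ℂ, (U : Matrix ι ι ℂ) *ᵥ v = w := by
  rcases eq_or_ne v 0 with rfl | hv
  · exact ⟨1, Eq.symm (by simpa using h.symm)⟩
  obtain ⟨i, -⟩ := Function.ne_iff.mp hv
  set r : ℂ := (‖WithLp.toLp 2 v‖ : ℂ) with hr
  have hr0 : r ≠ 0 := by simpa [hr] using hv
  have normalized (u : ι → ℂ) (hu : ‖WithLp.toLp 2 u‖ = ‖WithLp.toLp 2 v‖) :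
      ∃ U : Matrix.unitaryGroup ι ℂ, (U : Matrix ι ι ℂ) *ᵥ Pi.single i 1 = r⁻¹ • u := by
    refine exists_unitary_mulVec_single_eq i ?_
    rw [WithLp.toLp_smul, norm_smul, norm_inv, hu, hr, Complex.norm_real, norm_norm]
    exact inv_mul_cancel₀ (by simpa using hv)
  obtain ⟨V, hV⟩ := normalized v rfl
  obtain ⟨W, hW⟩ := normalized w h.symm
  refine ⟨W * V⁻¹, ?_⟩
  have hVv : ((V⁻¹ : Matrix.unitaryGroup ι ℂ) : Matrix ι ι ℂ) *ᵥ v = r • Pi.single i 1 := by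
    rw [← smul_inv_smul₀ hr0 v, ← hV, Matrix.mulVec_smul, Matrix.mulVec_mulVec,
      ← Submonoid.coe_mul, inv_mul_cancel, OneMemClass.coe_one, Matrix.one_mulVec]
  rw [Submonoid.coe_mul, ← Matrix.mulVec_mulVec, hVv, Matrix.mulVec_smul, hW,
    smul_inv_smul₀ hr0]

end UnitaryVectors

lemma integral_haarUnitary_mulVec_congr {E : Type*} [NormedAddCommGroup E] [NormedSpace ℝ E]
    {n : ℕ} {v w : Fin n → ℂ} (h : ‖WithLp.toLp 2 v‖ = ‖WithLp.toLp 2 w‖)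
    (f : (Fin n → ℂ) → E) :
    ∫ U, f ((U : Matrix (Fin n) (Fin n) ℂ) *ᵥ v) ∂haarUnitary n =
      ∫ U, f ((U : Matrix (Fin n) (Fin n) ℂ) *ᵥ w) ∂haarUnitary n := by
  obtain ⟨V, rfl⟩ := exists_unitary_mulVec_eq_of_norm_eq h
  simpa [Matrix.mulVec_mulVec] using (integral_mul_right_eq_self (μ := haarUnitary n)
    (fun U => f ((U : Matrix (Fin n) (Fin n) ℂ) *ᵥ v)) V).symm

section WeightedNorm

variable {ι : Type*} [Fintype ι]

/-- The weighted squared norm `∑ i, b i * ‖x i‖ ^ 2`: the quadratic form of `diagonal b`. -/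
noncomputable def weightedNormSq (b : ι → ℝ) (x : ι → ℂ) : ℝ := ∑ i, b i * ‖x i‖ ^ 2

@[fun_prop]
lemma continuous_weightedNormSq (b : ι → ℝ) : Continuous (weightedNormSq b) := by
  unfold weightedNormSq
  fun_prop

lemma weightedNormSq_const (c : ℝ) (x : ι → ℂ) :
    weightedNormSq (fun _ => c) x = c * ‖WithLp.toLp 2 x‖ ^ 2 := by
  rw [weightedNormSq, EuclideanSpace.norm_sq_eq, Finset.mul_sum]

lemma weightedNormSq_const_add_mul (a c : ℝ) (b : ι → ℝ) (x : ι → ℂ) :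
    weightedNormSq (fun i => a + c * b i) x =
      a * ‖WithLp.toLp 2 x‖ ^ 2 + c * weightedNormSq b x := by
  simp only [weightedNormSq, EuclideanSpace.norm_sq_eq, add_mul, Finset.sum_add_distrib,
    Finset.mul_sum, mul_assoc]

lemma weightedNormSq_smul (b : ι → ℝ) (c : ℂ) (x : ι → ℂ) :
    weightedNormSq b (c • x) = ‖c‖ ^ 2 * weightedNormSq b x := by
  simp only [weightedNormSq, Pi.smul_apply, norm_smul, mul_pow, Finset.mul_sum]
  exact Finset.sum_congr rfl fun i _ => by ring

lemma exists_pos_mul_norm_sq_le_weightedNormSq {b : ι → ℝ} (hb : ∀ i, 0 < b i) :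
    ∃ ε > 0, ∀ x, ε * ‖WithLp.toLp 2 x‖ ^ 2 ≤ weightedNormSq b x := by
  obtain ⟨ε, hε, hεb⟩ : ∃ ε > 0, ∀ i, ε ≤ b i := by
    cases isEmpty_or_nonempty ι
    · exact ⟨1, one_pos, isEmptyElim⟩
    · obtain ⟨i, hi⟩ := Finite.exists_min b
      exact ⟨b i, hb i, hi⟩
  refine ⟨ε, hε, fun x => ?_⟩
  rw [← weightedNormSq_const]
  exact Finset.sum_le_sum fun i _ => by gcongr; exact hεb i

lemma weightedNormSq_pos {b : ι → ℝ} (hb : ∀ i, 0 < b i) {x : ι → ℂ} (hx : x ≠ 0) :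
    0 < weightedNormSq b x := by
  obtain ⟨i, hi⟩ := Function.ne_iff.mp hx
  exact Finset.sum_pos' (fun j _ => mul_nonneg (hb j).le (sq_nonneg _))
    ⟨i, Finset.mem_univ i, mul_pos (hb i) (pow_pos (norm_pos_iff.mpr hi) 2)⟩

lemma integrable_exp_neg_mul_norm_sq {c : ℝ} (hc : 0 < c) :
    Integrable fun z : ℂ => Real.exp (-c * ‖z‖ ^ 2) := by
  refine Integrable.of_integral_ne_zero ?_
  rw [GaussianFourier.integral_rexp_neg_mul_sq_norm hc]
  positivity

lemma exp_neg_weightedNormSq (b : ι → ℝ) (x : ι → ℂ) :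
    Real.exp (-weightedNormSq b x) = ∏ i, Real.exp (-b i * ‖x i‖ ^ 2) := by
  simp [weightedNormSq, ← Real.exp_sum]

lemma integrable_exp_neg_weightedNormSq {b : ι → ℝ} (hb : ∀ i, 0 < b i) :
    Integrable fun x => Real.exp (-weightedNormSq b x) := by
  simp_rw [exp_neg_weightedNormSq]
  exact Integrable.fintype_prod fun i => integrable_exp_neg_mul_norm_sq (hb i)

lemma integral_exp_neg_weightedNormSq {b : ι → ℝ} (hb : ∀ i, 0 < b i) :
    ∫ x, Real.exp (-weightedNormSq b x) = ∏ i, Real.pi / b i := by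
  simp_rw [exp_neg_weightedNormSq]
  rw [integral_fintype_prod_volume_eq_prod (f := fun i (z : ℂ) => Real.exp (-b i * ‖z‖ ^ 2))]
  refine Finset.prod_congr rfl fun i _ => ?_
  rw [GaussianFourier.integral_rexp_neg_mul_sq_norm (hb i)]
  simp [Complex.finrank_real_complex]

lemma integral_exp_neg_mul_norm_sq {c : ℝ} (hc : 0 < c) :
    ∫ x : ι → ℂ, Real.exp (-(c * ‖WithLp.toLp 2 x‖ ^ 2)) = (Real.pi / c) ^ Fintype.card ι := by
  simp_rw [← weightedNormSq_const]
  rw [integral_exp_neg_weightedNormSq fun _ => hc, Finset.prod_const, Finset.card_univ]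

end WeightedNorm

lemma measurePreserving_unitary_mulVec {ι : Type*} [Fintype ι] [DecidableEq ι]
    (U : Matrix.unitaryGroup ι ℂ) :
    MeasurePreserving fun x : ι → ℂ => (U : Matrix ι ι ℂ) *ᵥ x := by
  set f : (ι → ℂ) →ₗ[ℝ] (ι → ℂ) := (Matrix.toLin' (U : Matrix ι ι ℂ)).restrictScalars ℝ with hf
  have norm_det : ‖(U : Matrix ι ι ℂ).det‖ = 1 :=
    CStarRing.norm_of_mem_unitary (Matrix.det_of_mem_unitary U.2)
  have abs_det : |LinearMap.det f| = 1 := by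
    rw [hf, LinearMap.det_restrictScalars, LinearMap.det_toLin', Algebra.norm_complex_apply,
      Complex.normSq_eq_norm_sq, norm_det, one_pow, abs_one]
  have det_ne_zero : LinearMap.det f ≠ 0 := fun h => by simp [h] at abs_det
  have map_eq := Measure.map_linearMap_addHaar_eq_smul_addHaar
    (volume : Measure (ι → ℂ)) det_ne_zero
  rw [abs_inv, abs_det, inv_one, ENNReal.ofReal_one, one_smul] at map_eq
  exact ⟨by fun_prop, map_eq⟩

section GaussianTrick

variable {n : ℕ}

lemma integrable_exp_neg_of_norm_sq_le
    {f : Matrix.unitaryGroup (Fin n) ℂ × (Fin n → ℂ) → ℝ} (hf : Continuous f)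
    {ε : ℝ} (hε : 0 < ε) (hle : ∀ z, ε * ‖WithLp.toLp 2 z.2‖ ^ 2 ≤ f z) :
    Integrable (fun z => Real.exp (-f z)) ((haarUnitary n).prod volume) := by
  have gaussian : Integrable fun x : Fin n → ℂ => Real.exp (-(ε * ‖WithLp.toLp 2 x‖ ^ 2)) := by
    simpa only [weightedNormSq_const] using
      integrable_exp_neg_weightedNormSq fun _ : Fin n => hε
  refine (gaussian.comp_snd (haarUnitary n)).mono' (by fun_prop) (.of_forall fun z => ?_)
  simpa using hle z

lemma integral_haarUnitary_exp_neg_weightedNormSq {v : Fin n → ℂ} (hv : v ≠ 0) (b : Fin n → ℝ)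
    (x : Fin n → ℂ) :
    ∫ U, Real.exp (-weightedNormSq b ((U : Matrix (Fin n) (Fin n) ℂ) *ᵥ x)) ∂haarUnitary n =
      ∫ U, Real.exp (-(weightedNormSq b ((U : Matrix (Fin n) (Fin n) ℂ) *ᵥ v) /
        ‖WithLp.toLp 2 v‖ ^ 2 * ‖WithLp.toLp 2 x‖ ^ 2)) ∂haarUnitary n := by
  have hv' : ‖WithLp.toLp 2 v‖ ≠ 0 := by simpa using hv
  set r : ℂ := ((‖WithLp.toLp 2 x‖ / ‖WithLp.toLp 2 v‖ : ℝ) : ℂ) with hr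
  have norm_r : ‖r‖ = ‖WithLp.toLp 2 x‖ / ‖WithLp.toLp 2 v‖ := by
    rw [hr, Complex.norm_real, Real.norm_of_nonneg (by positivity)]
  have same_norm : ‖WithLp.toLp 2 x‖ = ‖WithLp.toLp 2 (r • v)‖ := by
    rw [WithLp.toLp_smul, norm_smul, norm_r, div_mul_cancel₀ _ hv']
  rw [integral_haarUnitary_mulVec_congr same_norm fun y => Real.exp (-weightedNormSq b y)]
  simp_rw [Matrix.mulVec_smul, weightedNormSq_smul, norm_r]
  exact integral_congr_ae (.of_forall fun U => by ring_nf)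

lemma integral_exp_neg_weightedNormSq_unitary_mulVec (U : Matrix.unitaryGroup (Fin n) ℂ)
    {b : Fin n → ℝ} (hb : ∀ i, 0 < b i) :
    ∫ x, Real.exp (-weightedNormSq b ((U : Matrix (Fin n) (Fin n) ℂ) *ᵥ x)) =
      Real.pi ^ n * ∏ i, 1 / b i := by
  have hU := measurePreserving_unitary_mulVec U
  rw [← integral_map (f := fun x => Real.exp (-weightedNormSq b x)) hU.aemeasurable
    (by fun_prop), hU.map_eq, integral_exp_neg_weightedNormSq hb]
  simp [div_eq_mul_inv, Finset.prod_mul_distrib]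

lemma integrable_exp_neg_weightedNormSq_unitary_mulVec {b : Fin n → ℝ} (hb : ∀ i, 0 < b i) :
    Integrable (fun z : Matrix.unitaryGroup (Fin n) ℂ × (Fin n → ℂ) =>
      Real.exp (-weightedNormSq b ((z.1 : Matrix (Fin n) (Fin n) ℂ) *ᵥ z.2)))
      ((haarUnitary n).prod volume) := by
  obtain ⟨ε, hε, hεb⟩ := exists_pos_mul_norm_sq_le_weightedNormSq hb
  refine integrable_exp_neg_of_norm_sq_le ((continuous_weightedNormSq b).comp
    ((continuous_subtype_val.comp continuous_fst).matrix_mulVec continuous_snd)) hε fun z => ?_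
  simpa only [norm_unitary_mulVec] using hεb ((z.1 : Matrix _ _ ℂ) *ᵥ z.2)

lemma integral_integral_exp_neg_mul_norm_sq_swap {c : Matrix.unitaryGroup (Fin n) ℂ → ℝ}
    (hc : Continuous c) (hpos : ∀ U, 0 < c U) :
    ∫ U, (∫ x : Fin n → ℂ, Real.exp (-(c U * ‖WithLp.toLp 2 x‖ ^ 2))) ∂haarUnitary n =
      ∫ x : Fin n → ℂ, ∫ U, Real.exp (-(c U * ‖WithLp.toLp 2 x‖ ^ 2)) ∂haarUnitary n := by
  obtain ⟨U₀, -, hU₀⟩ := isCompact_univ.exists_isMinOn Set.univ_nonempty hc.continuousOn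
  refine integral_integral_swap (integrable_exp_neg_of_norm_sq_le
    (f := fun z => c z.1 * ‖WithLp.toLp 2 z.2‖ ^ 2) (by fun_prop) (hpos U₀) fun z => ?_)
  gcongr
  exact hU₀ (Set.mem_univ z.1)

-- Both sides come from the integral of a Gaussian over the unitary group and the vector: its
-- radial part produces the power of the quadratic form, its rotation invariance the product.
theorem integral_haarUnitary_norm_sq_div_weightedNormSq_pow {v : Fin n → ℂ} (hv : v ≠ 0)
    {b : Fin n → ℝ} (hb : ∀ i, 0 < b i) :
    ∫ U, (‖WithLp.toLp 2 v‖ ^ 2 /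
        weightedNormSq b ((U : Matrix (Fin n) (Fin n) ℂ) *ᵥ v)) ^ n ∂haarUnitary n =
      ∏ i, 1 / b i := by
  have norm_pos : 0 < ‖WithLp.toLp 2 v‖ := norm_pos_iff.mpr (by simpa using hv)
  set ratio : Matrix.unitaryGroup (Fin n) ℂ → ℝ := fun U =>
    weightedNormSq b ((U : Matrix (Fin n) (Fin n) ℂ) *ᵥ v) / ‖WithLp.toLp 2 v‖ ^ 2 with hratio
  have ratio_pos (U) : 0 < ratio U :=
    div_pos (weightedNormSq_pos hb (unitary_mulVec_ne_zero U hv)) (by positivity)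
  have continuous_ratio : Continuous ratio :=
    ((continuous_weightedNormSq b).comp
      (continuous_subtype_val.matrix_mulVec continuous_const)).div_const _
  have radial (U) : ∫ x : Fin n → ℂ, Real.exp (-(ratio U * ‖WithLp.toLp 2 x‖ ^ 2)) =
      Real.pi ^ n * (‖WithLp.toLp 2 v‖ ^ 2 /
        weightedNormSq b ((U : Matrix (Fin n) (Fin n) ℂ) *ᵥ v)) ^ n := by
    rw [integral_exp_neg_mul_norm_sq (ratio_pos U), Fintype.card_fin, ← mul_pow, hratio,
      ← div_mul, mul_comm_div]
  refine mul_left_cancel₀ (pow_ne_zero n Real.pi_ne_zero) ?_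
  calc Real.pi ^ n * ∫ U, (‖WithLp.toLp 2 v‖ ^ 2 /
          weightedNormSq b ((U : Matrix (Fin n) (Fin n) ℂ) *ᵥ v)) ^ n ∂haarUnitary n
      = ∫ U, (∫ x : Fin n → ℂ, Real.exp (-(ratio U * ‖WithLp.toLp 2 x‖ ^ 2)))
          ∂haarUnitary n := by simp_rw [radial, integral_const_mul]
    _ = ∫ x : Fin n → ℂ, ∫ U, Real.exp (-(ratio U * ‖WithLp.toLp 2 x‖ ^ 2)) ∂haarUnitary n :=
        integral_integral_exp_neg_mul_norm_sq_swap continuous_ratio ratio_pos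
    _ = ∫ x, ∫ U, Real.exp (-weightedNormSq b ((U : Matrix (Fin n) (Fin n) ℂ) *ᵥ x))
          ∂haarUnitary n := by simp_rw [integral_haarUnitary_exp_neg_weightedNormSq hv, hratio]
    _ = ∫ U, (∫ x, Real.exp (-weightedNormSq b ((U : Matrix (Fin n) (Fin n) ℂ) *ᵥ x)))
          ∂haarUnitary n :=
        (integral_integral_swap (integrable_exp_neg_weightedNormSq_unitary_mulVec hb)).symm
    _ = Real.pi ^ n * ∏ i, 1 / b i := by
        simp [integral_exp_neg_weightedNormSq_unitary_mulVec _ hb]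

end GaussianTrick

section Andreief

variable {ι X 𝕜 : Type*} [Fintype ι] [DecidableEq ι] [MeasurableSpace X] [RCLike 𝕜]
  {ν : Measure X} [SigmaFinite ν]

lemma integrable_det {h : ι → ι → X → 𝕜} (hh : ∀ a b, Integrable (h a b) ν) :
    Integrable (fun x : ι → X => (Matrix.of fun a b => h a b (x a)).det)
      (Measure.pi fun _ => ν) := by
  simp_rw [← Matrix.det_transpose (Matrix.of fun a b => h a b _), Matrix.det_apply']
  exact integrable_finsetSum _ fun τ _ =>
    (Integrable.fintype_prod fun a => hh a (τ a)).const_mul _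

lemma integral_det {h : ι → ι → X → 𝕜} (hh : ∀ a b, Integrable (h a b) ν) :
    ∫ x : ι → X, (Matrix.of fun a b => h a b (x a)).det ∂(Measure.pi fun _ => ν) =
      (Matrix.of fun a b => ∫ x, h a b x ∂ν).det := by
  simp_rw [← Matrix.det_transpose (Matrix.of fun _ _ => _), Matrix.det_apply',
    Matrix.transpose_apply, Matrix.of_apply]
  rw [integral_finsetSum _ fun τ _ =>
    (Integrable.fintype_prod fun a => hh a (τ a)).const_mul _]
  simp_rw [integral_const_mul, integral_fintype_prod_eq_prod (fun a => h a (_ : ι))]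

theorem integral_det_mul_det {f g : ι → X → 𝕜}
    (hfg : ∀ a b, Integrable (fun x => f a x * g b x) ν) :
    ∫ x : ι → X, (Matrix.of fun a b => f b (x a)).det * (Matrix.of fun a b => g b (x a)).det
        ∂(Measure.pi fun _ => ν) =
      (Fintype.card ι).factorial * (Matrix.of fun a b => ∫ x, f a x * g b x ∂ν).det := by
  have expand (x : ι → X) :
      (Matrix.of fun a b => f b (x a)).det * (Matrix.of fun a b => g b (x a)).det =
        ∑ σ : Equiv.Perm ι, ((Equiv.Perm.sign σ : ℤ) : 𝕜) *
          (Matrix.of fun a b => f (σ a) (x a) * g b (x a)).det := by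
    rw [← Matrix.det_transpose (Matrix.of fun a b => f b (x a)), Matrix.det_apply',
      Finset.sum_mul]
    refine Finset.sum_congr rfl fun σ _ => ?_
    rw [mul_assoc]
    exact congrArg _ (Matrix.det_mul_column _ _).symm
  have permuted (σ : Equiv.Perm ι) : ((Equiv.Perm.sign σ : ℤ) : 𝕜) *
      (Matrix.of fun a b => ∫ x, f (σ a) x * g b x ∂ν).det =
        (Matrix.of fun a b => ∫ x, f a x * g b x ∂ν).det := by
    have det_permute := Matrix.det_permute σ (Matrix.of fun a b => ∫ x, f a x * g b x ∂ν)
    refine (congrArg _ det_permute).trans ?_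
    rw [← mul_assoc, ← Int.cast_mul, ← Units.val_mul, Int.units_mul_self]
    simp
  simp_rw [expand]
  rw [integral_finsetSum _ fun σ _ => (integrable_det fun a => hfg (σ a)).const_mul _]
  simp_rw [integral_const_mul, integral_det fun _ => hfg _, permuted]
  simp [Fintype.card_perm]

end Andreief

/-- Monic polynomials `p j` of degree `j` and functions `q j`, biorthonormal for the measure `ν`. -/
structure IsBiorthonormalSystem (ν : Measure ℝ) {n : ℕ} (p : Fin n → Polynomial ℝ)
    (q : Fin n → ℝ → ℝ) : Prop where
  monic : ∀ j, (p j).Monic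
  natDegree_eq : ∀ j, (p j).natDegree = (j : ℕ)
  integrable : ∀ a b, Integrable (fun x => (p a).eval x * q b x) ν
  integral_eq : ∀ a b, ∫ x, (p a).eval x * q b x ∂ν = if a = b then 1 else 0

/-- The matrix of coefficients of the polynomials `p j` with respect to the monomials. -/
def coeffMatrix {n : ℕ} (p : Fin n → Polynomial ℝ) : Matrix (Fin n) (Fin n) ℝ :=
  Matrix.of fun a b => (p a).coeff b

/-- The matrix of the moments `∫ x ^ a * q b x` of the functions `q b`. -/
noncomputable def momentMatrix (ν : Measure ℝ) {n : ℕ} (q : Fin n → ℝ → ℝ) :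
    Matrix (Fin n) (Fin n) ℝ :=
  Matrix.of fun a b => ∫ x, x ^ (a : ℕ) * q b x ∂ν

lemma det_updateRow_eq_det_mul_vecMul {ι R : Type*} [Fintype ι] [DecidableEq ι] [CommRing R]
    {A C : Matrix ι ι R} (hAC : A * C = 1) (i : ι) (v : ι → R) :
    (C.updateRow i v).det = C.det * (v ᵥ* A) i := by
  have adjugate_eq : C.adjugate = C.det • A := by
    rw [← Matrix.one_mul C.adjugate, ← hAC, Matrix.mul_assoc, Matrix.mul_adjugate,
      Matrix.mul_smul, Matrix.mul_one]
  rw [← Matrix.cramer_transpose_apply, Matrix.cramer_eq_adjugate_mulVec,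
    ← Matrix.adjugate_transpose,
    adjugate_eq, Matrix.mulVec_transpose, Matrix.vecMul_smul, Pi.smul_apply, smul_eq_mul]

namespace IsBiorthonormalSystem

variable {ν : Measure ℝ} {n : ℕ} {p : Fin n → Polynomial ℝ} {q : Fin n → ℝ → ℝ}

lemma coeff_self (h : IsBiorthonormalSystem ν p q) (j : Fin n) : (p j).coeff j = 1 := by
  simpa only [h.natDegree_eq] using (h.monic j).coeff_natDegree

lemma integrable_pow_mul (h : IsBiorthonormalSystem ν p q) (a b : Fin n) :
    Integrable (fun x => x ^ (a : ℕ) * q b x) ν := by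
  induction a using WellFoundedLT.induction with
  | ind a ih =>
    have lower_terms : Integrable
        (fun x => ∑ i : Fin a, (p a).coeff i * (x ^ (i : ℕ) * q b x)) ν :=
      integrable_finsetSum _ fun i _ => (ih (Fin.castLE a.2.le i) i.2).const_mul _
    refine ((h.integrable a b).sub lower_terms).congr (.of_forall fun x => ?_)
    have eval_eq : (p a).eval x = (∑ i : Fin a, (p a).coeff i * x ^ (i : ℕ)) + x ^ (a : ℕ) := by
      rw [Polynomial.eval_eq_sum_range, h.natDegree_eq, Finset.sum_range_succ, h.coeff_self,
        one_mul, Finset.sum_range]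
    simp only [Pi.sub_apply, eval_eq, add_mul, Finset.sum_mul, mul_assoc, add_sub_cancel_left]

lemma eval_eq_sum (h : IsBiorthonormalSystem ν p q) (j : Fin n) (x : ℝ) :
    (p j).eval x = ∑ i : Fin n, coeffMatrix p j i * x ^ (i : ℕ) := by
  rw [Polynomial.eval_eq_sum_range' (h.natDegree_eq j ▸ j.2), Finset.sum_range]
  rfl

lemma det_coeffMatrix (h : IsBiorthonormalSystem ν p q) : (coeffMatrix p).det = 1 := by
  rw [Matrix.det_of_isLowerTriangular]
  · exact Finset.prod_eq_one fun j _ => h.coeff_self j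
  · intro i j hij
    exact Polynomial.coeff_eq_zero_of_natDegree_lt (h.natDegree_eq i ▸ hij)

lemma coeffMatrix_mul_momentMatrix (h : IsBiorthonormalSystem ν p q) :
    coeffMatrix p * momentMatrix ν q = 1 := by
  ext j b
  simp_rw [Matrix.mul_apply, Matrix.one_apply, ← h.integral_eq j b, momentMatrix,
    Matrix.of_apply, ← integral_const_mul]
  rw [← integral_finsetSum _ fun i _ => (h.integrable_pow_mul i b).const_mul _]
  simp_rw [h.eval_eq_sum j, Finset.sum_mul, mul_assoc]

lemma det_momentMatrix (h : IsBiorthonormalSystem ν p q) : (momentMatrix ν q).det = 1 := by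
  simpa [h.det_coeffMatrix] using congrArg Matrix.det h.coeffMatrix_mul_momentMatrix

end IsBiorthonormalSystem

section ResolventWeight

variable {ν : Measure ℝ} {m : ℕ} {q : Fin (m + 1) → ℝ → ℝ} {p : Fin (m + 1) → Polynomial ℝ}

lemma integrable_div_add_mul (hν : ∀ᵐ x ∂ν, 0 < x) {s : ℝ} (hs : 0 ≤ s) {g : ℝ → ℝ}
    (hg : Integrable g ν) : Integrable (fun x => x / (x + s) * g x) ν := by
  refine hg.bdd_mul (c := 1) (Measurable.aestronglyMeasurable (by fun_prop)) ?_
  filter_upwards [hν] with x hx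
  rw [Real.norm_of_nonneg (by positivity)]
  exact div_le_one_of_le₀ (by linarith) (by linarith)

-- The row operations rest on
-- `x ^ (i + 1) = (x / (x + s)) * x ^ (i + 1) + s * (x / (x + s)) * x ^ i`.
lemma det_momentMatrix_div_add_mul (hν : ∀ᵐ x ∂ν, 0 < x)
    (hq : ∀ a b : Fin (m + 1), Integrable (fun x => x ^ (a : ℕ) * q b x) ν)
    {s : ℝ} (hs : 0 ≤ s) :
    (momentMatrix ν fun b x => x / (x + s) * q b x).det =
      ((momentMatrix ν q).updateRow 0 fun b => ∫ x, x / (x + s) * q b x ∂ν).det := by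
  have integrable_weighted (a b : Fin (m + 1)) :
      Integrable (fun x => x ^ (a : ℕ) * (x / (x + s) * q b x)) ν := by
    simpa only [mul_left_comm] using integrable_div_add_mul hν hs (hq a b)
  refine Matrix.det_eq_of_forall_row_eq_smul_add_pred (fun _ => -s)
    (fun j => by simp [momentMatrix]) fun i j => ?_
  rw [Matrix.updateRow_ne (Fin.succ_ne_zero i)]
  simp only [momentMatrix, Matrix.of_apply]
  rw [← integral_const_mul, ← integral_add (hq _ _) ((integrable_weighted _ _).const_mul _)]
  refine integral_congr_ae ?_
  filter_upwards [hν] with x hx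
  have : x + s ≠ 0 := by positivity
  rw [Fin.val_succ, Fin.val_castSucc]
  field_simp
  ring

lemma IsBiorthonormalSystem.det_momentMatrix_div_add_mul (h : IsBiorthonormalSystem ν p q)
    (hν : ∀ᵐ x ∂ν, 0 < x) {s : ℝ} (hs : 0 ≤ s) :
    (momentMatrix ν fun b x => x / (x + s) * q b x).det =
      ∫ x, polyKernel p q 0 x * (x / (x + s)) ∂ν := by
  have integrable_q (b) : Integrable (q b) ν := by simpa using h.integrable_pow_mul 0 b
  rw [_root_.det_momentMatrix_div_add_mul hν h.integrable_pow_mul hs,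
    det_updateRow_eq_det_mul_vecMul h.coeffMatrix_mul_momentMatrix, h.det_momentMatrix, one_mul]
  simp_rw [Matrix.vecMul, dotProduct, ← integral_mul_const]
  rw [← integral_finsetSum _ fun b _ =>
    (integrable_div_add_mul hν hs (integrable_q b)).mul_const _]
  refine integral_congr_ae (.of_forall fun x => ?_)
  simp only [polyKernel, Finset.sum_mul, ← Polynomial.coeff_zero_eq_eval_zero, coeffMatrix,
    Matrix.of_apply, Fin.val_zero]
  exact Finset.sum_congr rfl fun b _ => by ring

end ResolventWeight

section EigenvalueDensity

variable {n : ℕ} {q : Fin n → ℝ → ℝ} {w : ℝ → ℝ}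

lemma restrict_positiveOrthant (n : ℕ) :
    (volume : Measure (Fin n → ℝ)).restrict (positiveOrthant n) =
      Measure.pi fun _ : Fin n => (volume : Measure ℝ).restrict (Ioi 0) := by
  have : positiveOrthant n = Set.pi Set.univ fun _ => Ioi (0 : ℝ) := by
    ext
    simp [positiveOrthant]
  rw [this, volume_pi, Measure.restrict_pi_pi]

lemma eigenvalueDensity_mul_prod (q : Fin n → ℝ → ℝ) (w : ℝ → ℝ) (lam : Fin n → ℝ) :
    eigenvalueDensity q lam * ∏ i, w (lam i) =
      (n.factorial : ℝ)⁻¹ * ((Matrix.of fun a b : Fin n => lam a ^ (b : ℕ)).det *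
        (Matrix.of fun a b : Fin n => w (lam a) * q b (lam a)).det) := by
  have det_mul_column := Matrix.det_mul_column (fun a => w (lam a))
    (Matrix.of fun a b : Fin n => q b (lam a))
  simp only [Matrix.of_apply] at det_mul_column
  rw [det_mul_column, eigenvalueDensity, ← Matrix.det_vandermonde, Matrix.vandermonde]
  ring

lemma integral_eigenvalueDensity_mul_prod
    (hw : ∀ a b : Fin n, IntegrableOn (fun x => x ^ (a : ℕ) * (w x * q b x)) (Ioi 0)) :
    ∫ lam in positiveOrthant n, eigenvalueDensity q lam * ∏ i, w (lam i) =
      (momentMatrix (volume.restrict (Ioi 0)) fun b x => w x * q b x).det := by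
  simp_rw [eigenvalueDensity_mul_prod]
  rw [integral_const_mul, restrict_positiveOrthant,
    integral_det_mul_det (f := fun (a : Fin n) x => x ^ (a : ℕ)) hw, Fintype.card_fin,
    inv_mul_cancel_left₀ (by positivity)]
  rfl

end EigenvalueDensity

theorem IsBiorthonormalSystem.integral_eigenvalueDensity_mul_prod_div_add {m : ℕ}
    {p : Fin (m + 1) → Polynomial ℝ} {q : Fin (m + 1) → ℝ → ℝ}
    (h : IsBiorthonormalSystem (volume.restrict (Ioi 0)) p q) {s : ℝ} (hs : 0 ≤ s) :
    ∫ lam in positiveOrthant (m + 1), eigenvalueDensity q lam * ∏ i, (lam i / (lam i + s)) =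
      ∫ x in Ioi (0 : ℝ), polyKernel p q 0 x * (x / (x + s)) := by
  have ae_pos : ∀ᵐ x ∂(volume.restrict (Ioi (0 : ℝ))), 0 < x := ae_restrict_mem measurableSet_Ioi
  rw [← h.det_momentMatrix_div_add_mul ae_pos hs]
  refine integral_eigenvalueDensity_mul_prod (w := fun x => x / (x + s)) fun a b => ?_
  simpa only [mul_left_comm, IntegrableOn] using
    integrable_div_add_mul ae_pos hs (h.integrable_pow_mul a b)

section ResolventMoments

open scoped BoundedContinuousFunction

lemma ext_of_forall_integral_pow {E : Type*} [TopologicalSpace E] [PolishSpace E]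
    [MeasurableSpace E] [BorelSpace E] {α β : Measure E} [IsFiniteMeasure α] [IsFiniteMeasure β]
    {e : E →ᵇ ℝ} (he : Function.Injective e)
    (h : ∀ m : ℕ, ∫ x, e x ^ m ∂α = ∫ x, e x ^ m ∂β) : α = β := by
  let A : StarSubalgebra ℝ (E →ᵇ ℝ) :=
    { Algebra.adjoin ℝ {e} with
      star_mem' := fun {a} ha => by rwa [show star a = a by ext x; simp] }
  refine ext_of_forall_mem_subalgebra_integral_eq_of_polish (𝕜 := ℝ) (A := A) ?_ ?_
  · exact fun x y hxy => ⟨e, ⟨BoundedContinuousFunction.toContinuousMapStarₐ ℝ e,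
      ⟨e, Algebra.subset_adjoin rfl, rfl⟩, rfl⟩, fun h => hxy (he h)⟩
  · intro g hg
    obtain ⟨p, rfl⟩ : ∃ p : Polynomial ℝ, Polynomial.aeval e p = g := by
      rwa [← AlgHom.mem_range, ← Algebra.adjoin_singleton_eq_range_aeval]
    have aeval_apply (x : E) : (Polynomial.aeval e p) x
        = ∑ i ∈ Finset.range (p.natDegree + 1), p.coeff i * e x ^ i := by
      rw [Polynomial.aeval_eq_sum_range]
      simp
    have integrable_pow (γ : Measure E) [IsFiniteMeasure γ] (i : ℕ) :
        Integrable (fun x => e x ^ i) γ := (e ^ i).integrable γ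
    simp_rw [aeval_apply]
    rw [integral_finsetSum _ fun i _ => (integrable_pow α i).const_mul _,
      integral_finsetSum _ fun i _ => (integrable_pow β i).const_mul _]
    simp [integral_const_mul, h]

/-- A bounded continuous injective function on the line, equal to `1 / (x + 1)` for `0 ≤ x`. -/
noncomputable def reciprocalSuccAbs : ℝ →ᵇ ℝ :=
  BoundedContinuousFunction.ofNormedAddCommGroup (fun x : ℝ => 1 - x / (1 + |x|))
    (continuous_const.sub (continuous_id.div (by fun_prop) fun x => by positivity)) 2 fun x => by
      have abs_le_one : |x / (1 + |x|)| ≤ 1 := by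
        rw [abs_div, abs_of_pos (show 0 < 1 + |x| by positivity)]
        exact div_le_one_of_le₀ (by linarith) (by positivity)
      rw [Real.norm_eq_abs, abs_le]
      constructor <;> linarith [abs_le.mp abs_le_one]

lemma reciprocalSuccAbs_of_nonneg {x : ℝ} (hx : 0 ≤ x) : reciprocalSuccAbs x = 1 / (x + 1) := by
  change 1 - x / (1 + |x|) = _
  rw [abs_of_nonneg hx]
  field_simp
  ring

lemma injective_reciprocalSuccAbs : Function.Injective reciprocalSuccAbs := by
  intro x y hxy
  have h : x / (1 + |x|) = y / (1 + |y|) := sub_right_injective hxy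
  rw [div_eq_div_iff (by positivity) (by positivity)] at h
  rcases abs_cases x with ⟨hx, _⟩ | ⟨hx, _⟩ <;> rcases abs_cases y with ⟨hy, _⟩ | ⟨hy, _⟩ <;>
    rw [hx, hy] at h <;> nlinarith

variable {α β : Measure ℝ} {n k : ℕ}

lemma integral_reciprocalSuccAbs_pow_withDensity (hα : ∀ᵐ x ∂α, 0 < x) (m : ℕ) :
    ∫ x, reciprocalSuccAbs x ^ m ∂(α.withDensity fun x => ENNReal.ofReal ((x / (x + 1)) ^ n)) =
      ∫ x, x ^ n / (x + 1) ^ (n + m) ∂α := by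
  rw [integral_withDensity_eq_integral_toReal_smul (by fun_prop)
    (.of_forall fun _ => ENNReal.ofReal_lt_top)]
  refine integral_congr_ae ?_
  filter_upwards [hα] with x hx
  rw [reciprocalSuccAbs_of_nonneg hx.le, ENNReal.toReal_ofReal (by positivity), smul_eq_mul,
    div_pow, div_pow, one_pow, pow_add, div_mul_div_comm, mul_one]

variable [IsFiniteMeasure α] [IsFiniteMeasure β]

lemma abs_pow_div_add_pow_le (hnk : n ≤ k) {x t r : ℝ} (hx : 0 < x) (hr : 0 < r)
    (hrt : r ≤ t) : |x ^ n / (x + t) ^ k| ≤ (1 / r) ^ (k - n) := by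
  have hxt : 0 < x + t := by linarith
  obtain ⟨d, rfl⟩ := Nat.exists_eq_add_of_le hnk
  rw [abs_of_nonneg (by positivity), Nat.add_sub_cancel_left]
  calc x ^ n / (x + t) ^ (n + d)
      = (x / (x + t)) ^ n * (1 / (x + t)) ^ d := by
        rw [pow_add, div_pow, div_pow, one_pow, div_mul_div_comm, mul_one]
    _ ≤ 1 * (1 / r) ^ d := by
        gcongr
        · exact pow_le_one₀ (by positivity) (div_le_one_of_le₀ (by linarith) hxt.le)
        · linarith
    _ = (1 / r) ^ d := one_mul _

lemma integrable_pow_div_add_pow (hα : ∀ᵐ x ∂α, 0 < x) (hnk : n ≤ k) {s : ℝ} (hs : 0 < s) :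
    Integrable (fun x => x ^ n / (x + s) ^ k) α := by
  refine .of_bound (Measurable.aestronglyMeasurable (by fun_prop)) ((1 / s) ^ (k - n)) ?_
  filter_upwards [hα] with x hx using abs_pow_div_add_pow_le hnk hx hs le_rfl

lemma hasDerivAt_pow_div_add_pow {x t : ℝ} (hxt : x + t ≠ 0) :
    HasDerivAt (fun t => x ^ n / (x + t) ^ k) (-(k * (x ^ n / (x + t) ^ (k + 1)))) t := by
  have deriv_inv :=
    ((((hasDerivAt_id t).const_add x).pow k).inv (pow_ne_zero k hxt)).const_mul (x ^ n)
  convert! deriv_inv using 1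
  rcases k with _ | k
  · simp
  · simp only [id, Nat.add_sub_cancel, Pi.pow_apply]
    field_simp
    ring

lemma hasDerivAt_integral_pow_div_add_pow (hα : ∀ᵐ x ∂α, 0 < x) (hnk : n ≤ k) {s : ℝ}
    (hs : 0 < s) :
    HasDerivAt (fun t => ∫ x, x ^ n / (x + t) ^ k ∂α)
      (-(k * ∫ x, x ^ n / (x + s) ^ (k + 1) ∂α)) s := by
  rw [← integral_const_mul, ← integral_neg]
  refine (hasDerivAt_integral_of_dominated_loc_of_deriv_le (μ := α)
    (F' := fun t x => -(k * (x ^ n / (x + t) ^ (k + 1))))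
    (bound := fun _ => k * (1 / (s / 2)) ^ (k + 1 - n)) (s := Ioi (s / 2))
    (Ioi_mem_nhds (by linarith))
    (.of_forall fun t => Measurable.aestronglyMeasurable (by fun_prop))
    (integrable_pow_div_add_pow hα hnk hs)
    (Measurable.aestronglyMeasurable (by fun_prop)) ?_ (integrable_const _) ?_).2
  · filter_upwards [hα] with x hx t ht
    rw [norm_neg, norm_mul, Real.norm_natCast]
    gcongr
    exact abs_pow_div_add_pow_le (by omega) hx (by linarith) (le_of_lt ht)
  · filter_upwards [hα] with x hx t ht
    have : s / 2 < t := ht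
    exact hasDerivAt_pow_div_add_pow (by linarith)

lemma integral_pow_div_add_pow_congr (hα : ∀ᵐ x ∂α, 0 < x) (hβ : ∀ᵐ x ∂β, 0 < x)
    (hn : n ≠ 0) (h : ∀ s > 0, ∫ x, (x / (x + s)) ^ n ∂α = ∫ x, (x / (x + s)) ^ n ∂β) (m : ℕ) :
    ∀ s > 0, ∫ x, x ^ n / (x + s) ^ (n + m) ∂α = ∫ x, x ^ n / (x + s) ^ (n + m) ∂β := by
  induction m with
  | zero => simpa only [div_pow, add_zero] using h
  | succ m ih =>
    intro s hs
    have deriv_α := hasDerivAt_integral_pow_div_add_pow hα (Nat.le_add_right n m) hs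
    have deriv_β := hasDerivAt_integral_pow_div_add_pow hβ (Nat.le_add_right n m) hs
    have eventually_eq : (fun t => ∫ x, x ^ n / (x + t) ^ (n + m) ∂β) =ᶠ[nhds s]
        fun t => ∫ x, x ^ n / (x + t) ^ (n + m) ∂α := by
      filter_upwards [Ioi_mem_nhds hs] with t ht using (ih t ht).symm
    have deriv_eq := (deriv_α.congr_of_eventuallyEq eventually_eq).unique deriv_β
    exact mul_left_cancel₀ (by positivity) (neg_inj.mp deriv_eq)

-- Differentiating in `s` gives all the integrals of `x ^ n / (x + 1) ^ (n + m)`, the moments of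
-- the injective bounded function `1 / (x + 1)` for the measure with weight `(x / (x + 1)) ^ n`.
theorem measure_ext_of_integral_div_add_pow (hα : ∀ᵐ x ∂α, 0 < x) (hβ : ∀ᵐ x ∂β, 0 < x)
    (hn : n ≠ 0) (h : ∀ s > 0, ∫ x, (x / (x + s)) ^ n ∂α = ∫ x, (x / (x + s)) ^ n ∂β) :
    α = β := by
  set w : ℝ → ENNReal := fun x => ENNReal.ofReal ((x / (x + 1)) ^ n)
  have finite_weighted {γ : Measure ℝ} [IsFiniteMeasure γ] (hγ : ∀ᵐ x ∂γ, 0 < x) :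
      IsFiniteMeasure (γ.withDensity w) :=
    isFiniteMeasure_withDensity_ofReal
      (by simpa only [div_pow] using (integrable_pow_div_add_pow hγ le_rfl one_pos).2)
  have withDensity_inv {γ : Measure ℝ} (hγ : ∀ᵐ x ∂γ, 0 < x) :
      (γ.withDensity w).withDensity w⁻¹ = γ := by
    refine withDensity_inv_same₀ (by fun_prop) ?_ (.of_forall fun _ => ENNReal.ofReal_ne_top)
    filter_upwards [hγ] with x hx
    exact (ENNReal.ofReal_pos.mpr (by positivity)).ne'
  have := finite_weighted hα
  have := finite_weighted hβ
  have weighted_eq : α.withDensity w = β.withDensity w :=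
    ext_of_forall_integral_pow injective_reciprocalSuccAbs fun m => by
      rw [integral_reciprocalSuccAbs_pow_withDensity hα,
        integral_reciprocalSuccAbs_pow_withDensity hβ,
        integral_pow_div_add_pow_congr hα hβ hn h m 1 one_pos]
  rw [← withDensity_inv hα, weighted_eq, withDensity_inv hβ]

end ResolventMoments

section SignedDensity

variable {X : Type*} [MeasurableSpace X] {l ν : Measure X} {ρ : X → ℝ}

lemma ae_nonneg_of_withDensity_neg_le [SigmaFinite l] (hρ : AEMeasurable ρ l)
    (h : l.withDensity (fun x => ENNReal.ofReal (-ρ x)) ≤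
      l.withDensity fun x => ENNReal.ofReal (ρ x)) : ∀ᵐ x ∂l, 0 ≤ ρ x := by
  have neg_le : ∀ᵐ x ∂l, ENNReal.ofReal (-ρ x) ≤ ENNReal.ofReal (ρ x) := by
    refine ae_le_of_forall_setLIntegral_le_of_sigmaFinite₀ hρ.neg.ennreal_ofReal fun s hs _ => ?_
    simpa only [withDensity_apply _ hs] using h s
  filter_upwards [neg_le] with x hx
  by_contra! hneg
  rw [ENNReal.ofReal_of_nonpos hneg.le, nonpos_iff_eq_zero, ENNReal.ofReal_eq_zero] at hx
  linarith

lemma eq_withDensity_of_add_withDensity_neg_eq [SigmaFinite l] (hρ : AEMeasurable ρ l)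
    (h : ν + l.withDensity (fun x => ENNReal.ofReal (-ρ x)) =
      l.withDensity fun x => ENNReal.ofReal (ρ x)) :
    (∀ᵐ x ∂l, 0 ≤ ρ x) ∧ ν = l.withDensity fun x => ENNReal.ofReal (ρ x) := by
  have nonneg := ae_nonneg_of_withDensity_neg_le hρ (h ▸ Measure.le_add_left le_rfl)
  refine ⟨nonneg, ?_⟩
  have neg_part_eq_zero : l.withDensity (fun x => ENNReal.ofReal (-ρ x)) = 0 := by
    have : AEMeasurable (fun x => ENNReal.ofReal (-ρ x)) l := hρ.neg.ennreal_ofReal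
    rw [withDensity_eq_zero_iff this]
    filter_upwards [nonneg] with x hx
    simpa using hx
  rw [← h, neg_part_eq_zero, add_zero]

lemma integral_withDensity_ofReal (hρ : AEMeasurable ρ l) (f : X → ℝ) :
    ∫ x, f x ∂(l.withDensity fun x => ENNReal.ofReal (ρ x)) = ∫ x, max (ρ x) 0 * f x ∂l := by
  rw [integral_withDensity_eq_integral_toReal_smul₀ hρ.ennreal_ofReal
    (.of_forall fun x => ENNReal.ofReal_lt_top)]
  simp only [ENNReal.toReal_ofReal', smul_eq_mul]

end SignedDensity

theorem eq_withDensity_of_integral_div_add_pow {l ν : Measure ℝ} [SigmaFinite l]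
    [IsFiniteMeasure ν] (hl : ∀ᵐ x ∂l, 0 < x) (hν : ∀ᵐ x ∂ν, 0 < x) {ρ : ℝ → ℝ}
    (hρ : Integrable ρ l) {n : ℕ} (hn : n ≠ 0)
    (h : ∀ s > 0, ∫ x, (x / (x + s)) ^ n ∂ν = ∫ x, ρ x * (x / (x + s)) ^ n ∂l) :
    (∀ᵐ x ∂l, 0 ≤ ρ x) ∧ ν = l.withDensity fun x => ENNReal.ofReal (ρ x) := by
  refine eq_withDensity_of_add_withDensity_neg_eq hρ.aemeasurable ?_
  have := isFiniteMeasure_withDensity_ofReal hρ.2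
  have := isFiniteMeasure_withDensity_ofReal hρ.neg.2
  have pos_withDensity (f : ℝ → ENNReal) : ∀ᵐ x ∂l.withDensity f, 0 < x :=
    withDensity_absolutelyContinuous l f hl
  have integrable_resolvent {γ : Measure ℝ} [IsFiniteMeasure γ] (hγ : ∀ᵐ x ∂γ, 0 < x) {s : ℝ}
      (hs : 0 < s) : Integrable (fun x => (x / (x + s)) ^ n) γ := by
    simpa only [div_pow] using integrable_pow_div_add_pow hγ le_rfl hs
  refine measure_ext_of_integral_div_add_pow (ae_add_measure_iff.mpr
    ⟨hν, pos_withDensity _⟩) (pos_withDensity _) hn fun s hs => ?_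
  have integrable_mul {f : ℝ → ℝ} (hf : Integrable f l) :
      Integrable (fun x => f x * (x / (x + s)) ^ n) l := by
    refine hf.mul_bdd (c := 1) (Measurable.aestronglyMeasurable (by fun_prop)) ?_
    filter_upwards [hl] with x hx
    rw [Real.norm_eq_abs, div_pow]
    simpa only [Nat.sub_self, pow_zero] using abs_pow_div_add_pow_le (le_refl n) hx hs le_rfl
  rw [integral_add_measure (integrable_resolvent hν hs)
      (integrable_resolvent (pos_withDensity _) hs),
    h s hs, integral_withDensity_ofReal hρ.aemeasurable,
    integral_withDensity_ofReal (ρ := fun x => -ρ x) hρ.neg.aemeasurable,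
    ← integral_add (integrable_mul hρ)
      (integrable_mul (f := fun x => max (-ρ x) 0) hρ.neg.pos_part)]
  refine integral_congr_ae (.of_forall fun x => ?_)
  simp only [← add_mul]
  congr 1
  rcases le_total (ρ x) 0 with h0 | h0
  · rw [max_eq_left (by linarith), max_eq_right h0, add_neg_cancel]
  · rw [max_eq_right (by linarith), max_eq_left h0, add_zero]

section QuotientDensity

/-- The density on `(0, ∞)` of `Y / (c X)`, for independent `Y` with density `k` on `(0, ∞)` and
`X` with density `w` on `(0, 1]`; here `k` and `w` may take negative values. -/
noncomputable def quotientDensity (k w : ℝ → ℝ) (c γ : ℝ) : ℝ :=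
  c * ∫ x in Ioc (0 : ℝ) 1, k (c * γ * x) * w x * x

variable {k w h : ℝ → ℝ} {c : ℝ}

lemma quasiMeasurePreserving_const_mul_Ioi {a : ℝ} (ha : 0 < a) :
    Measure.QuasiMeasurePreserving (fun y => a * y) (volume.restrict (Ioi 0))
      (volume.restrict (Ioi 0)) := by
  refine ⟨by fun_prop, ?_⟩
  have preimage_eq : (fun y => a * y) ⁻¹' Ioi 0 = Ioi 0 := by
    rw [preimage_const_mul_Ioi₀ _ ha, zero_div]
  have map_restrict := Measure.restrict_map (μ := volume) (measurable_const_mul a)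
    (measurableSet_Ioi (a := (0 : ℝ)))
  rw [preimage_eq, Real.map_volume_mul_left ha.ne'] at map_restrict
  rw [← map_restrict]
  exact Measure.smul_absolutelyContinuous.restrict _

lemma ae_mem_Ioc_prod_Ioi :
    ∀ᵐ z ∂((volume.restrict (Ioc (0 : ℝ) 1)).prod (volume.restrict (Ioi (0 : ℝ)))),
      z.1 ∈ Ioc (0 : ℝ) 1 ∧ z.2 ∈ Ioi (0 : ℝ) := by
  rw [Measure.prod_restrict]
  exact ae_restrict_mem (measurableSet_Ioc.prod measurableSet_Ioi)

lemma mul_integral_Ioi_comp_mul_left {a : ℝ} (ha : 0 < a) (f : ℝ → ℝ) :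
    ∫ y in Ioi (0 : ℝ), a * f (a * y) = ∫ y in Ioi (0 : ℝ), f y := by
  rw [integral_const_mul, integral_comp_mul_left_Ioi f 0 ha, mul_zero, smul_eq_mul,
    mul_inv_cancel_left₀ ha.ne']

lemma dilation_integrand_eq (hc : 0 < c) {x : ℝ} (hx : 0 < x) (γ : ℝ) :
    c * (k (c * γ * x) * w x * x) * h γ =
      c * x * (fun y => k y * w x * h (y / (c * x))) (c * x * γ) := by
  simp only
  rw [mul_div_cancel_left₀ _ (mul_pos hc hx).ne', mul_right_comm c γ x]
  ring

lemma aestronglyMeasurable_dilation (hk : AEStronglyMeasurable k (volume.restrict (Ioi 0)))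
    (hw : AEStronglyMeasurable w (volume.restrict (Ioc 0 1))) (hh : Measurable h) (hc : 0 < c) :
    AEStronglyMeasurable (fun z : ℝ × ℝ => c * (k (c * z.2 * z.1) * w z.1 * z.1) * h z.2)
      ((volume.restrict (Ioc 0 1)).prod (volume.restrict (Ioi 0))) := by
  have comp_mul : AEStronglyMeasurable (fun z : ℝ × ℝ => k (c * z.2 * z.1))
      ((volume.restrict (Ioc 0 1)).prod (volume.restrict (Ioi 0))) := by
    refine hk.comp_quasiMeasurePreserving (f := fun z : ℝ × ℝ => c * z.2 * z.1)
      (QuasiMeasurePreserving.prod_of_right (by fun_prop) ?_)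
    filter_upwards [ae_restrict_mem measurableSet_Ioc] with x hx
    simpa only [mul_right_comm c x] using quasiMeasurePreserving_const_mul_Ioi (mul_pos hc hx.1)
  exact (((comp_mul.mul hw.comp_fst).mul (Measurable.aestronglyMeasurable (by fun_prop))).const_mul
    c).mul (Measurable.aestronglyMeasurable (by fun_prop))

lemma integrable_dilation (hk : AEStronglyMeasurable k (volume.restrict (Ioi 0)))
    (hw : AEStronglyMeasurable w (volume.restrict (Ioc 0 1))) (hh : Measurable h) (hc : 0 < c)
    (H : Integrable (fun z : ℝ × ℝ => k z.2 * w z.1 * h (z.2 / (c * z.1)))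
      ((volume.restrict (Ioc 0 1)).prod (volume.restrict (Ioi 0)))) :
    Integrable (fun z : ℝ × ℝ => c * (k (c * z.2 * z.1) * w z.1 * z.1) * h z.2)
      ((volume.restrict (Ioc 0 1)).prod (volume.restrict (Ioi 0))) := by
  obtain ⟨slices, norms⟩ := (integrable_prod_iff H.1).mp H
  refine (integrable_prod_iff (aestronglyMeasurable_dilation hk hw hh hc)).mpr ⟨?_, ?_⟩
  · filter_upwards [slices, ae_restrict_mem measurableSet_Ioc] with x slice hx
    have hcx : 0 < c * x := mul_pos hc hx.1
    simp only [dilation_integrand_eq hc hx.1]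
    exact ((integrableOn_Ioi_comp_mul_left_iff (fun y => k y * w x * h (y / (c * x))) 0 hcx).mpr
      (by rwa [mul_zero])).const_mul (c * x)
  · refine norms.congr ?_
    filter_upwards [ae_restrict_mem measurableSet_Ioc] with x hx
    have hcx : 0 < c * x := mul_pos hc hx.1
    simp only [dilation_integrand_eq hc hx.1, norm_mul (c * x), Real.norm_of_nonneg hcx.le]
    exact (mul_integral_Ioi_comp_mul_left hcx fun y => ‖k y * w x * h (y / (c * x))‖).symm

lemma quotientDensity_mul (γ : ℝ) :
    quotientDensity k w c γ * h γ =
      ∫ x in Ioc (0 : ℝ) 1, c * (k (c * γ * x) * w x * x) * h γ := by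
  rw [integral_mul_const, integral_const_mul, quotientDensity]

lemma integrableOn_quotientDensity_mul (hk : AEStronglyMeasurable k (volume.restrict (Ioi 0)))
    (hw : AEStronglyMeasurable w (volume.restrict (Ioc 0 1))) (hh : Measurable h) (hc : 0 < c)
    (H : Integrable (fun z : ℝ × ℝ => k z.2 * w z.1 * h (z.2 / (c * z.1)))
      ((volume.restrict (Ioc 0 1)).prod (volume.restrict (Ioi 0)))) :
    IntegrableOn (fun γ => quotientDensity k w c γ * h γ) (Ioi 0) := by
  simp_rw [quotientDensity_mul]
  exact (integrable_dilation hk hw hh hc H).integral_prod_right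

theorem integral_quotientDensity_mul (hk : AEStronglyMeasurable k (volume.restrict (Ioi 0)))
    (hw : AEStronglyMeasurable w (volume.restrict (Ioc 0 1))) (hh : Measurable h) (hc : 0 < c)
    (H : Integrable (fun z : ℝ × ℝ => k z.2 * w z.1 * h (z.2 / (c * z.1)))
      ((volume.restrict (Ioc 0 1)).prod (volume.restrict (Ioi 0)))) :
    ∫ γ in Ioi (0 : ℝ), quotientDensity k w c γ * h γ =
      ∫ y in Ioi (0 : ℝ), k y * ∫ x in Ioc (0 : ℝ) 1, w x * h (y / (c * x)) := by
  calc ∫ γ in Ioi (0 : ℝ), quotientDensity k w c γ * h γ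
      = ∫ γ in Ioi (0 : ℝ), ∫ x in Ioc (0 : ℝ) 1, c * (k (c * γ * x) * w x * x) * h γ := by
        simp_rw [quotientDensity_mul]
    _ = ∫ x in Ioc (0 : ℝ) 1, ∫ γ in Ioi (0 : ℝ), c * (k (c * γ * x) * w x * x) * h γ :=
        (integral_integral_swap (integrable_dilation hk hw hh hc H)).symm
    _ = ∫ x in Ioc (0 : ℝ) 1, ∫ y in Ioi (0 : ℝ), k y * w x * h (y / (c * x)) := by
        refine setIntegral_congr_fun measurableSet_Ioc fun x hx => ?_
        simp only [dilation_integrand_eq hc hx.1]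
        exact mul_integral_Ioi_comp_mul_left (mul_pos hc hx.1) fun y => k y * w x * h (y / (c * x))
    _ = ∫ y in Ioi (0 : ℝ), ∫ x in Ioc (0 : ℝ) 1, k y * w x * h (y / (c * x)) :=
        integral_integral_swap H
    _ = ∫ y in Ioi (0 : ℝ), k y * ∫ x in Ioc (0 : ℝ) 1, w x * h (y / (c * x)) := by
        simp_rw [mul_assoc, integral_const_mul]

lemma integrable_mul_mul_comp_div_of_abs_le_one (hk : IntegrableOn k (Ioi 0))
    (hw : IntegrableOn w (Ioc 0 1)) (hh : Measurable h) (hb : ∀ x, 0 < x → |h x| ≤ 1)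
    (hc : 0 < c) :
    Integrable (fun z : ℝ × ℝ => k z.2 * w z.1 * h (z.2 / (c * z.1)))
      ((volume.restrict (Ioc 0 1)).prod (volume.restrict (Ioi 0))) := by
  have integrable_mul := hw.mul_prod hk
  simp only [mul_comm (w _)] at integrable_mul
  refine integrable_mul.mul_bdd (c := 1) (Measurable.aestronglyMeasurable (by fun_prop)) ?_
  filter_upwards [ae_mem_Ioc_prod_Ioi] with z hz
  exact hb _ (div_pos hz.2 (mul_pos hc hz.1.1))

lemma abs_log_one_add_div_mul_le {x y : ℝ} (hx : x ∈ Ioc (0 : ℝ) 1) (hy : 0 < y) (hc : 0 < c) :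
    |Real.log (1 + y / (c * x))| ≤ y / c + |Real.log x| := by
  have hx0 : 0 < x := hx.1
  have log_add_le := Real.log_le_sub_one_of_pos (show 0 < x + y / c by positivity)
  rw [abs_of_nonneg (Real.log_nonneg (le_add_of_nonneg_right (by positivity))),
    show 1 + y / (c * x) = (x + y / c) / x by field_simp,
    Real.log_div (by positivity) hx0.ne']
  linarith [hx.2, neg_le_abs (Real.log x)]

lemma integrable_mul_mul_log_one_add_div (hk : IntegrableOn k (Ioi 0))
    (hk₁ : IntegrableOn (fun y => y * k y) (Ioi 0)) (hw : IntegrableOn w (Ioc 0 1))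
    (hwlog : IntegrableOn (fun x => w x * Real.log x) (Ioc 0 1)) (hc : 0 < c) :
    Integrable (fun z : ℝ × ℝ => k z.2 * w z.1 * Real.log (1 + z.2 / (c * z.1)))
      ((volume.restrict (Ioc 0 1)).prod (volume.restrict (Ioi 0))) := by
  have bound_integrable := (hw.norm.mul_prod (hk₁.norm.const_mul c⁻¹)).add
    (hwlog.norm.mul_prod hk.norm)
  refine bound_integrable.mono' ((hk.1.comp_snd.mul hw.1.comp_fst).mul
    (Measurable.aestronglyMeasurable (by fun_prop))) ?_
  filter_upwards [ae_mem_Ioc_prod_Ioi] with z ⟨hx, hy⟩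
  have hy : 0 < z.2 := hy
  simp only [Pi.add_apply, norm_mul, Real.norm_eq_abs, abs_of_pos hy]
  calc |k z.2| * |w z.1| * |Real.log (1 + z.2 / (c * z.1))|
      ≤ |k z.2| * |w z.1| * (z.2 / c + |Real.log z.1|) := by
        gcongr
        exact abs_log_one_add_div_mul_le hx hy hc
    _ = |w z.1| * (c⁻¹ * (z.2 * |k z.2|)) + |w z.1| * |Real.log z.1| * |k z.2| := by ring

lemma integrableOn_comp_mul_mul_mul (hk : IntegrableOn k (Ioi 0)) (hw : Continuous w) {a : ℝ}
    (ha : 0 < a) : IntegrableOn (fun x => k (a * x) * w x * x) (Ioc 0 1) := by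
  have comp_mul : IntegrableOn (fun x => k (a * x)) (Ioi 0) :=
    (integrableOn_Ioi_comp_mul_left_iff k 0 ha).mpr (by rwa [mul_zero])
  obtain ⟨C, hC⟩ := isCompact_Icc.exists_bound_of_continuousOn
    (s := Icc (0 : ℝ) 1) (hw.mul continuous_id).continuousOn
  simp_rw [mul_assoc]
  refine (comp_mul.mono_set Ioc_subset_Ioi_self).mul_bdd (c := C)
    (hw.mul continuous_id).aestronglyMeasurable ?_
  filter_upwards [ae_restrict_mem measurableSet_Ioc] with x hx using hC x (Ioc_subset_Icc_self hx)

lemma continuousOn_integral_mul_comp_div (hk : IntegrableOn k (Ioi 0)) {g : ℝ → ℝ}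
    (hg : Measurable g) {C a : ℝ} (hgC : ∀ u, 0 < u → |g u| ≤ C)
    (hga : ∀ u, u ≠ a → ContinuousAt g u) :
    ContinuousOn (fun T => ∫ y in Ioi (0 : ℝ), k y * g (y / T)) (Ioi 0) := by
  intro T₀ (hT₀ : 0 < T₀)
  refine (continuousAt_of_dominated (bound := fun y => ‖k y‖ * C) (.of_forall fun T =>
    hk.1.mul (Measurable.aestronglyMeasurable (by fun_prop))) ?_ (hk.norm.mul_const C)
    ?_).continuousWithinAt
  · filter_upwards [Ioi_mem_nhds hT₀] with T hT
    filter_upwards [ae_restrict_mem measurableSet_Ioi] with y hy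
    rw [Pi.mul_apply, norm_mul]
    exact mul_le_mul_of_nonneg_left (hgC _ (div_pos hy hT)) (norm_nonneg _)
  · filter_upwards [ae_restrict_of_ae (Measure.ae_ne volume (a * T₀))] with y hy
    refine continuousAt_const.mul (ContinuousAt.comp (f := fun T => y / T) (hga _ ?_)
      (continuousAt_const.div continuousAt_id hT₀.ne'))
    rwa [Ne, div_eq_iff hT₀.ne']

lemma quotientDensity_eq_integral_Ioi {γ : ℝ} (hγ : 0 < c * γ) :
    quotientDensity k w c γ =
      c * ((c * γ)⁻¹ * ∫ y in Ioi (0 : ℝ),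
        k y * (Iic 1).indicator (fun u => w u * u) (y / (c * γ))) := by
  rw [quotientDensity, ← mul_integral_Ioi_comp_mul_left hγ, integral_const_mul,
    inv_mul_cancel_left₀ hγ.ne', ← Ioi_inter_Iic, ← setIntegral_indicator measurableSet_Iic]
  refine congrArg _ (integral_congr_ae (.of_forall fun x => ?_))
  simp only [indicator_apply, mul_div_cancel_left₀ _ hγ.ne', mul_ite, mul_zero, ← mul_assoc]

lemma continuousOn_quotientDensity (hk : IntegrableOn k (Ioi 0)) (hw : Continuous w)
    (hc : 0 < c) : ContinuousOn (quotientDensity k w c) (Ioi 0) := by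
  have hwid : Continuous fun u => w u * u := hw.mul continuous_id
  obtain ⟨C, hC⟩ := isCompact_Icc.exists_bound_of_continuousOn
    (s := Icc (0 : ℝ) 1) hwid.continuousOn
  have indicator_le (u : ℝ) (hu : 0 < u) : |(Iic 1).indicator (fun u => w u * u) u| ≤ C := by
    rw [indicator_apply]
    split_ifs with h
    · exact hC u ⟨hu.le, h⟩
    · simpa using (norm_nonneg _).trans (hC 0 (by simp))
  have indicator_continuousAt (u : ℝ) (hu : u ≠ 1) :
      ContinuousAt ((Iic 1).indicator fun u => w u * u) u :=
    hwid.continuousOn.continuousAt_indicator (by rwa [frontier_Iic, mem_singleton_iff])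
  refine ContinuousOn.congr ?_ fun γ hγ => quotientDensity_eq_integral_Ioi (mul_pos hc hγ)
  refine continuousOn_const.mul (ContinuousOn.mul
    (ContinuousOn.inv₀ (by fun_prop) fun γ hγ => (mul_pos hc hγ).ne') ?_)
  exact (continuousOn_integral_mul_comp_div hk (hwid.measurable.indicator measurableSet_Iic)
    indicator_le indicator_continuousAt).comp (by fun_prop) fun γ hγ => mul_pos hc hγ

end QuotientDensity

section BetaWeight

/-- The density `(m + 1) (1 - x) ^ m` on `(0, 1]` of the beta distribution with parameters `1` and
`m + 1`. -/
def betaWeight (m : ℕ) (x : ℝ) : ℝ := (m + 1) * (1 - x) ^ m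

variable {m : ℕ}

@[fun_prop]
lemma continuous_betaWeight : Continuous (betaWeight m) := by
  unfold betaWeight
  fun_prop

lemma integrableOn_betaWeight_mul_log :
    IntegrableOn (fun x => betaWeight m x * Real.log x) (Ioc 0 1) := by
  rw [← intervalIntegrable_iff_integrableOn_Ioc_of_le zero_le_one]
  exact intervalIntegral.intervalIntegrable_log'.continuousOn_mul
    continuous_betaWeight.continuousOn

lemma hasDerivAt_pow_div_add_mul {z s x : ℝ} (hzs : z + s ≠ 0) (hx : z + s * x ≠ 0) :
    HasDerivAt (fun x => -(z ^ (m + 2) / (z + s) * ((1 - x) / (z + s * x)) ^ (m + 1)))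
      (betaWeight m x * (z / (z + s * x)) ^ (m + 2)) x := by
  have deriv_num : HasDerivAt (fun x : ℝ => 1 - x) (-1) x := (hasDerivAt_id x).const_sub 1
  have deriv_den : HasDerivAt (fun x : ℝ => z + s * x) s x := by
    simpa using ((hasDerivAt_id x).const_mul s).const_add z
  convert! (((deriv_num.div deriv_den hx).pow (m + 1)).const_mul (z ^ (m + 2) / (z + s))).neg
    using 1
  simp only [betaWeight, Nat.add_sub_cancel, div_pow, Pi.div_apply]
  push_cast
  field_simp
  ring

theorem integral_betaWeight_mul_div_add_pow {z s : ℝ} (hz : 0 < z) (hs : 0 < s) :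
    ∫ x in Ioc (0 : ℝ) 1, betaWeight m x * (z / x / (z / x + s)) ^ (m + 2) = z / (z + s) := by
  have add_pos {x : ℝ} (hx : x ∈ Icc (0 : ℝ) 1) : 0 < z + s * x := by
    linarith [mul_nonneg hs.le hx.1]
  have clear_denominators : ∀ x ∈ Ioc (0 : ℝ) 1,
      betaWeight m x * (z / x / (z / x + s)) ^ (m + 2) =
        betaWeight m x * (z / (z + s * x)) ^ (m + 2) := by
    intro x hx
    have hx0 := hx.1
    have := add_pos (Ioc_subset_Icc_self hx)
    congr 2
    field_simp
  rw [setIntegral_congr_fun measurableSet_Ioc clear_denominators,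
    ← intervalIntegral.integral_of_le zero_le_one,
    intervalIntegral.integral_eq_sub_of_hasDerivAt
      (fun x hx => hasDerivAt_pow_div_add_mul (by positivity)
        (add_pos (uIcc_of_le (zero_le_one (α := ℝ)) ▸ hx)).ne')]
  · simp
    field_simp
    ring
  · refine ContinuousOn.intervalIntegrable ?_
    rw [uIcc_of_le zero_le_one]
    exact continuous_betaWeight.continuousOn.mul
      ((continuousOn_const.div (by fun_prop) fun x hx => (add_pos hx).ne').pow _)

end BetaWeight

section ZfDensity

variable {m : ℕ} {K : ℝ → ℝ → ℝ} {σ δ : ℝ}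

lemma zfDensity_eq_quotientDensity :
    zfDensity (m + 2) K σ δ = quotientDensity (K 0) (betaWeight m) (σ / δ) := by
  ext γ
  rw [zfDensity, intervalIntegral.integral_of_le zero_le_one, quotientDensity, mul_right_comm,
    ← integral_const_mul, mul_comm]
  refine congrArg _ (integral_congr_ae (.of_forall fun x => ?_))
  simp only [betaWeight, Nat.add_sub_cancel, show σ * γ * x / δ = σ / δ * γ * x by ring]
  push_cast
  ring

lemma continuousOn_zfDensity (hK : IntegrableOn (K 0) (Ioi 0)) (hσ : 0 < σ) (hδ : 0 < δ) :
    ContinuousOn (zfDensity (m + 2) K σ δ) (Ioi 0) :=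
  zfDensity_eq_quotientDensity ▸
    continuousOn_quotientDensity hK continuous_betaWeight (div_pos hσ hδ)

lemma integrableOn_zfDensity (hK : IntegrableOn (K 0) (Ioi 0)) (hσ : 0 < σ) (hδ : 0 < δ) :
    IntegrableOn (zfDensity (m + 2) K σ δ) (Ioi 0) := by
  rw [zfDensity_eq_quotientDensity]
  have hw : IntegrableOn (betaWeight m) (Ioc 0 1) := continuous_betaWeight.integrableOn_Ioc
  simpa using integrableOn_quotientDensity_mul hK.1 hw.1 measurable_const (div_pos hσ hδ)
    (integrable_mul_mul_comp_div_of_abs_le_one (h := fun _ => 1) hK hw measurable_const (by simp)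
      (div_pos hσ hδ))

lemma intervalIntegrable_zfDensity_integrand (hK : IntegrableOn (K 0) (Ioi 0)) (hσ : 0 < σ)
    (hδ : 0 < δ) {γ : ℝ} (hγ : 0 < γ) :
    IntervalIntegrable (fun x => K 0 (σ * γ * x / δ) * (1 - x) ^ m * x) volume 0 1 := by
  rw [intervalIntegrable_iff_integrableOn_Ioc_of_le zero_le_one]
  simpa only [mul_div_right_comm, mul_assoc] using integrableOn_comp_mul_mul_mul hK
    (w := fun x => (1 - x) ^ m) (by fun_prop) (a := σ / δ * γ) (by positivity)

theorem integral_zfDensity_mul_div_add_pow (hK : IntegrableOn (K 0) (Ioi 0)) (hσ : 0 < σ)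
    (hδ : 0 < δ) {s : ℝ} (hs : 0 < s) :
    ∫ γ in Ioi (0 : ℝ), zfDensity (m + 2) K σ δ γ * (γ / (γ + s)) ^ (m + 2) =
      ∫ y in Ioi (0 : ℝ), K 0 y * (y / (y + σ / δ * s)) := by
  have hc : 0 < σ / δ := div_pos hσ hδ
  have hw : IntegrableOn (betaWeight m) (Ioc 0 1) := continuous_betaWeight.integrableOn_Ioc
  have resolvent_le_one (x : ℝ) (hx : 0 < x) : |(x / (x + s)) ^ (m + 2)| ≤ 1 := by
    rw [abs_of_nonneg (by positivity)]
    exact pow_le_one₀ (by positivity) (div_le_one_of_le₀ (by linarith) (by positivity))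
  have resolvent_measurable : Measurable fun x : ℝ => (x / (x + s)) ^ (m + 2) := by fun_prop
  rw [zfDensity_eq_quotientDensity, integral_quotientDensity_mul hK.1 hw.1 resolvent_measurable hc
    (integrable_mul_mul_comp_div_of_abs_le_one hK hw resolvent_measurable resolvent_le_one hc)]
  refine setIntegral_congr_fun measurableSet_Ioi fun y (hy : 0 < y) => ?_
  have beta := integral_betaWeight_mul_div_add_pow (m := m) (div_pos hy hc) hs
  simp only [← div_div y, beta]
  field_simp

variable (hK : IntegrableOn (K 0) (Ioi 0)) (hK₁ : IntegrableOn (fun y => y * K 0 y) (Ioi 0))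
  (hσ : 0 < σ) (hδ : 0 < δ)

include hK hK₁ hσ hδ

lemma integrable_mul_betaWeight_mul_log :
    Integrable (fun z : ℝ × ℝ => K 0 z.2 * betaWeight m z.1 *
      Real.log (1 + z.2 / (σ / δ * z.1)))
      ((volume.restrict (Ioc 0 1)).prod (volume.restrict (Ioi 0))) :=
  integrable_mul_mul_log_one_add_div hK hK₁ continuous_betaWeight.integrableOn_Ioc
    integrableOn_betaWeight_mul_log (div_pos hσ hδ)

lemma integrableOn_zfDensity_mul_log :
    IntegrableOn (fun γ => zfDensity (m + 2) K σ δ γ * Real.log (1 + γ)) (Ioi 0) := by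
  rw [zfDensity_eq_quotientDensity]
  exact integrableOn_quotientDensity_mul hK.1 continuous_betaWeight.aestronglyMeasurable
    (by fun_prop) (div_pos hσ hδ) (integrable_mul_betaWeight_mul_log hK hK₁ hσ hδ)

lemma integrableOn_mul_integral_betaWeight_mul_log :
    IntegrableOn (fun y => K 0 y *
      ∫ x in Ioc (0 : ℝ) 1, betaWeight m x * Real.log (1 + δ / σ * y / x)) (Ioi 0) := by
  refine (integrable_mul_betaWeight_mul_log (m := m) hK hK₁ hσ hδ).integral_prod_right.congr
    (.of_forall fun y => ?_)
  simp only [mul_assoc, integral_const_mul]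
  simp only [← div_div y, div_div_eq_mul_div, mul_comm y, mul_div_right_comm]

theorem integral_zfDensity_mul_log :
    ∫ γ in Ioi (0 : ℝ), zfDensity (m + 2) K σ δ γ * Real.log (1 + γ) =
      ∫ y in Ioi (0 : ℝ), K 0 y *
        ∫ x in Ioc (0 : ℝ) 1, betaWeight m x * Real.log (1 + δ / σ * y / x) := by
  rw [zfDensity_eq_quotientDensity, integral_quotientDensity_mul hK.1
    continuous_betaWeight.aestronglyMeasurable (h := fun γ => Real.log (1 + γ)) (by fun_prop)
    (div_pos hσ hδ) (integrable_mul_betaWeight_mul_log hK hK₁ hσ hδ)]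
  simp only [← div_div _ (σ / δ), div_div_eq_mul_div, mul_comm _ δ, mul_div_right_comm]

end ZfDensity

section MellinBarnes

open scoped Real

section MellinOneDivOneAdd

variable {s : ℂ}

lemma integral_norm_exp_neg_mul_cpow_mul_exp_neg (h0 : 0 < s.re) {t : ℝ} (ht : 0 < t) :
    ∫ v in Ioi (0 : ℝ), ‖Complex.exp (-t) * ((v : ℂ) ^ (s - 1) * Complex.exp (-(t * v)))‖ =
      Real.exp (-t) * t ^ (1 - s.re - 1) * Real.Gamma s.re := by
  have integral_eq := Real.integral_rpow_mul_exp_neg_mul_Ioi h0 ht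
  rw [one_div, Real.inv_rpow ht.le, ← Real.rpow_neg ht.le] at integral_eq
  rw [sub_sub_cancel_left, mul_assoc, ← integral_eq, ← integral_const_mul]
  refine setIntegral_congr_fun measurableSet_Ioi fun v (hv : 0 < v) => ?_
  simp [Complex.norm_cpow_eq_rpow_re_of_pos hv, Complex.norm_exp]

lemma integrable_exp_neg_mul_cpow_mul_exp_neg (h0 : 0 < s.re) (h1 : s.re < 1) :
    Integrable (fun z : ℝ × ℝ =>
        Complex.exp (-z.1) * ((z.2 : ℂ) ^ (s - 1) * Complex.exp (-(z.1 * z.2))))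
      ((volume.restrict (Ioi 0)).prod (volume.restrict (Ioi 0))) := by
  refine (integrable_prod_iff (Measurable.aestronglyMeasurable (by fun_prop))).mpr ⟨?_, ?_⟩
  · filter_upwards [ae_restrict_mem measurableSet_Ioi] with t (ht : 0 < t)
    rw [← integrable_norm_iff (Measurable.aestronglyMeasurable (by fun_prop))]
    refine Integrable.of_integral_ne_zero ?_
    rw [integral_norm_exp_neg_mul_cpow_mul_exp_neg h0 ht]
    positivity
  · refine ((Real.GammaIntegral_convergent (sub_pos.mpr h1)).mul_const (Real.Gamma s.re)).congr ?_
    filter_upwards [ae_restrict_mem measurableSet_Ioi] with t ht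
    exact (integral_norm_exp_neg_mul_cpow_mul_exp_neg h0 ht).symm

lemma integral_exp_neg_mul_cpow_mul_exp_neg_left {v : ℝ} (hv : 0 < v) :
    ∫ t in Ioi (0 : ℝ), Complex.exp (-t) * ((v : ℂ) ^ (s - 1) * Complex.exp (-(t * v))) =
      (v : ℂ) ^ (s - 1) • (1 / (1 + v) : ℂ) := by
  have integral_exp := Complex.integral_cpow_mul_exp_neg_mul_Ioi (a := 1) (r := 1 + v) (by simp)
    (by positivity)
  simp only [sub_self, Complex.cpow_zero, one_mul, Complex.cpow_one, Complex.Gamma_one, mul_one,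
    Complex.ofReal_add, Complex.ofReal_one] at integral_exp
  rw [smul_eq_mul, ← integral_exp, ← integral_const_mul]
  refine integral_congr_ae (.of_forall fun t => ?_)
  simp only
  rw [mul_left_comm, ← Complex.exp_add]
  ring_nf

lemma integral_exp_neg_mul_cpow_mul_exp_neg_right (h0 : 0 < s.re) {t : ℝ} (ht : 0 < t) :
    ∫ v in Ioi (0 : ℝ), Complex.exp (-t) * ((v : ℂ) ^ (s - 1) * Complex.exp (-(t * v))) =
      Complex.Gamma s * ((t : ℂ) ^ ((1 - s) - 1) * Complex.exp (-(1 * t))) := by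
  rw [integral_const_mul, Complex.integral_cpow_mul_exp_neg_mul_Ioi h0 ht, one_div,
    Complex.inv_cpow _ _ (by rw [Complex.arg_ofReal_of_nonneg ht.le]; exact Real.pi_pos.ne),
    ← Complex.cpow_neg]
  ring_nf

lemma mellinConvergent_one_div_one_add (h0 : 0 < s.re) (h1 : s.re < 1) :
    MellinConvergent (fun v : ℝ => (1 / (1 + v) : ℂ)) s := by
  refine (integrable_exp_neg_mul_cpow_mul_exp_neg h0 h1).integral_prod_right.congr ?_
  filter_upwards [ae_restrict_mem measurableSet_Ioi] with v hv
  exact integral_exp_neg_mul_cpow_mul_exp_neg_left hv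

theorem mellin_one_div_one_add (h0 : 0 < s.re) (h1 : s.re < 1) :
    mellin (fun v : ℝ => (1 / (1 + v) : ℂ)) s = π / Complex.sin (π * s) := by
  calc ∫ v in Ioi (0 : ℝ), (v : ℂ) ^ (s - 1) • (1 / (1 + v) : ℂ)
      = ∫ v in Ioi (0 : ℝ), ∫ t in Ioi (0 : ℝ),
          Complex.exp (-t) * ((v : ℂ) ^ (s - 1) * Complex.exp (-(t * v))) :=
        setIntegral_congr_fun measurableSet_Ioi fun v hv =>
          (integral_exp_neg_mul_cpow_mul_exp_neg_left hv).symm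
    _ = ∫ t in Ioi (0 : ℝ), ∫ v in Ioi (0 : ℝ),
          Complex.exp (-t) * ((v : ℂ) ^ (s - 1) * Complex.exp (-(t * v))) :=
        (integral_integral_swap (integrable_exp_neg_mul_cpow_mul_exp_neg h0 h1)).symm
    _ = ∫ t in Ioi (0 : ℝ),
          Complex.Gamma s * ((t : ℂ) ^ ((1 - s) - 1) * Complex.exp (-(1 * t))) :=
        setIntegral_congr_fun measurableSet_Ioi fun t ht =>
          integral_exp_neg_mul_cpow_mul_exp_neg_right h0 ht
    _ = Complex.Gamma s * Complex.Gamma (1 - s) := by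
        have integral_Gamma := Complex.integral_cpow_mul_exp_neg_mul_Ioi (a := 1 - s) (r := 1)
          (by simpa using h1) (by simp)
        rw [Complex.ofReal_one, div_one, Complex.one_cpow, one_mul] at integral_Gamma
        rw [integral_const_mul, integral_Gamma]
    _ = π / Complex.sin (π * s) := Complex.Gamma_mul_Gamma_one_sub s

end MellinOneDivOneAdd

/-- The parametrization `t ↦ r + i t` of the vertical line `Re s = r`, the contour of all the
Mellin–Barnes integrals below. -/
noncomputable def verticalLine (r t : ℝ) : ℂ := r + t * Complex.I

@[simp]
lemma re_verticalLine (r t : ℝ) : (verticalLine r t).re = r := by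
  simp [verticalLine]

@[fun_prop]
lemma measurable_verticalLine (r : ℝ) : Measurable (verticalLine r) := by
  unfold verticalLine
  fun_prop

lemma one_add_sq_le_cosh_pi_mul (t : ℝ) : 1 + t ^ 2 ≤ Real.cosh (π * t) := by
  have cosh_eq : Real.cosh (π * t) = 1 + 2 * Real.sinh (π * t / 2) ^ 2 := by
    rw [show π * t = 2 * (π * t / 2) by ring, Real.cosh_two_mul, Real.cosh_sq]
    ring_nf
  have le_sinh : (π * t / 2) ^ 2 ≤ Real.sinh (π * t / 2) ^ 2 := by
    rw [sq_le_sq, Real.abs_sinh]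
    exact Real.self_le_sinh_iff.mpr (abs_nonneg _)
  have two_le_pi_sq : 2 ≤ π ^ 2 := by nlinarith [Real.pi_gt_three]
  nlinarith [sq_nonneg t]

lemma sin_pi_mul_mul_one_add_sq_le_norm_sin {r : ℝ} (h0 : 0 < r) (h1 : r < 1) (t : ℝ) :
    Real.sin (π * r) * (1 + t ^ 2) ≤ ‖Complex.sin (π * verticalLine r t)‖ := by
  have sin_pos : 0 < Real.sin (π * r) :=
    Real.sin_pos_of_pos_of_lt_pi (by positivity) (by nlinarith [Real.pi_pos])
  have re_sin : (Complex.sin (π * verticalLine r t)).re =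
      Real.sin (π * r) * Real.cosh (π * t) := by
    rw [verticalLine, mul_add, ← mul_assoc, ← Complex.ofReal_mul, ← Complex.ofReal_mul,
      Complex.sin_add_mul_I, ← Complex.ofReal_sin, ← Complex.ofReal_cosh, ← Complex.ofReal_cos,
      ← Complex.ofReal_sinh, Complex.add_re, ← Complex.ofReal_mul, ← Complex.ofReal_mul,
      Complex.re_ofReal_mul, Complex.ofReal_re, Complex.I_re, mul_zero, add_zero]
  calc Real.sin (π * r) * (1 + t ^ 2) ≤ Real.sin (π * r) * Real.cosh (π * t) := by
        gcongr
        exact one_add_sq_le_cosh_pi_mul t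
    _ ≤ ‖Complex.sin (π * verticalLine r t)‖ := re_sin ▸ Complex.re_le_norm _

lemma integrable_pi_div_sin_verticalLine {r : ℝ} (h0 : 0 < r) (h1 : r < 1) :
    Integrable fun t => π / Complex.sin (π * verticalLine r t) := by
  have sin_pos : 0 < Real.sin (π * r) :=
    Real.sin_pos_of_pos_of_lt_pi (by positivity) (by nlinarith [Real.pi_pos])
  refine (integrable_inv_one_add_sq.const_mul (π / Real.sin (π * r))).mono'
    (Measurable.aestronglyMeasurable (by fun_prop)) (.of_forall fun t => ?_)
  rw [norm_div, Complex.norm_real, Real.norm_of_nonneg Real.pi_pos.le, ← div_eq_mul_inv, div_div]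
  gcongr
  exact sin_pi_mul_mul_one_add_sq_le_norm_sin h0 h1 t

lemma inv_ofReal_cpow {v : ℝ} (hv : 0 ≤ v) (s : ℂ) : (v : ℂ)⁻¹ ^ s = (v : ℂ) ^ (-s) := by
  rw [Complex.inv_cpow _ _ (by rw [Complex.arg_ofReal_of_nonneg hv]; exact Real.pi_pos.ne),
    Complex.cpow_neg]

theorem ofReal_div_one_add_eq_integral {r : ℝ} (h0 : 0 < r) (h1 : r < 1) {v : ℝ} (hv : 0 < v) :
    ((v / (1 + v) : ℝ) : ℂ) = 1 / (2 * (π : ℂ)) *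
      ∫ t : ℝ, π / Complex.sin (π * verticalLine r t) * (v : ℂ) ^ verticalLine r t := by
  have mellin_eq (t : ℝ) : mellin (fun v : ℝ => (1 / (1 + v) : ℂ)) (r + t * Complex.I) =
      π / Complex.sin (π * verticalLine r t) :=
    mellin_one_div_one_add (by simpa using h0) (by simpa using h1)
  have ne_zero : (1 : ℂ) + ((v⁻¹ : ℝ) : ℂ) ≠ 0 := by
    rw [← Complex.ofReal_one, ← Complex.ofReal_add]
    exact Complex.ofReal_ne_zero.mpr (by positivity)
  have inversion := mellinInv_mellin_eq r (fun v : ℝ => (1 / (1 + v) : ℂ)) (inv_pos.mpr hv)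
    (mellinConvergent_one_div_one_add (s := r) (by simpa using h0) (by simpa using h1))
    (by simpa only [Complex.VerticalIntegrable, mellin_eq] using
      integrable_pi_div_sin_verticalLine h0 h1)
    (continuousAt_const.div (by fun_prop) ne_zero)
  calc ((v / (1 + v) : ℝ) : ℂ) = 1 / (1 + ((v⁻¹ : ℝ) : ℂ)) := by
        rw [← Complex.ofReal_one, ← Complex.ofReal_add, ← Complex.ofReal_div]
        congr 1
        field_simp
        ring
    _ = _ := by
        rw [← inversion, mellinInv, Complex.real_smul]
        simp only [mellin_eq, smul_eq_mul, Complex.ofReal_inv, inv_ofReal_cpow hv.le, neg_neg,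
          verticalLine]
        push_cast
        simp only [mul_comm]

section CpowSwap

variable {φ κ w : ℝ → ℂ} {ρ : ℝ}

lemma integrable_prod_mul_cpow (hφ : Integrable φ) (hκ : Measurable κ) (hre : ∀ t, (κ t).re = ρ)
    (hw : Measurable w) (hi : IntegrableOn (fun u : ℝ => ‖w u‖ * u ^ ρ) (Ioc 0 1)) :
    Integrable (fun z : ℝ × ℝ => w z.1 * (φ z.2 * (z.1 : ℂ) ^ κ z.2))
      ((volume.restrict (Ioc 0 1)).prod volume) := by
  refine (hi.mul_prod hφ.norm).mono' ?_ ?_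
  · exact AEStronglyMeasurable.mul (Measurable.aestronglyMeasurable (by fun_prop))
      (hφ.1.comp_snd.mul (Measurable.aestronglyMeasurable (by fun_prop)))
  · filter_upwards [Measure.quasiMeasurePreserving_fst.ae (ae_restrict_mem measurableSet_Ioc)]
      with z hz
    simp only [norm_mul, Complex.norm_cpow_eq_rpow_re_of_pos hz.1, hre]
    exact le_of_eq (by ring)

lemma integrable_mul_integral_mul_cpow (hφ : Integrable φ) (hκ : Measurable κ)
    (hre : ∀ t, (κ t).re = ρ) (hw : Measurable w)
    (hi : IntegrableOn (fun u : ℝ => ‖w u‖ * u ^ ρ) (Ioc 0 1)) :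
    Integrable fun t => φ t * ∫ u in Ioc (0 : ℝ) 1, w u * (u : ℂ) ^ κ t := by
  simpa only [mul_left_comm _ (φ _), integral_const_mul] using
    (integrable_prod_mul_cpow hφ hκ hre hw hi).integral_prod_right

lemma integral_mul_integral_mul_cpow_swap (hφ : Integrable φ) (hκ : Measurable κ)
    (hre : ∀ t, (κ t).re = ρ) (hw : Measurable w)
    (hi : IntegrableOn (fun u : ℝ => ‖w u‖ * u ^ ρ) (Ioc 0 1)) :
    ∫ u in Ioc (0 : ℝ) 1, w u * ∫ t, φ t * (u : ℂ) ^ κ t =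
      ∫ t, φ t * ∫ u in Ioc (0 : ℝ) 1, w u * (u : ℂ) ^ κ t := by
  have swap := integral_integral_swap (f := fun u t => w u * (φ t * (u : ℂ) ^ κ t))
    (integrable_prod_mul_cpow hφ hκ hre hw hi)
  simp only [integral_const_mul] at swap
  simpa only [mul_left_comm (w _), integral_const_mul] using swap

end CpowSwap

lemma log_one_add_eq_integral_div {w : ℝ} (hw : 0 ≤ w) :
    Real.log (1 + w) = ∫ u in Ioc (0 : ℝ) 1, w / (1 + w * u) := by
  have ne_zero : ∀ u ∈ uIcc (0 : ℝ) 1, 1 + w * u ≠ 0 := fun u hu => by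
    rw [uIcc_of_le zero_le_one] at hu
    have := mul_nonneg hw hu.1
    positivity
  rw [← intervalIntegral.integral_of_le zero_le_one,
    intervalIntegral.integral_eq_sub_of_hasDerivAt (f := fun u => Real.log (1 + w * u))]
  · simp
  · intro u hu
    have hasDerivAt_affine : HasDerivAt (fun u : ℝ => 1 + w * u) w u := by
      simpa using ((hasDerivAt_id u).const_mul w).const_add 1
    exact hasDerivAt_affine.log (ne_zero u hu)
  · exact (continuousOn_const.div (by fun_prop) ne_zero).intervalIntegrable

lemma integrableOn_rpow_Ioc {ρ : ℝ} (h : -1 < ρ) : IntegrableOn (fun u : ℝ => u ^ ρ) (Ioc 0 1) :=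
  (intervalIntegrable_iff_integrableOn_Ioc_of_le zero_le_one).mp
    (intervalIntegral.intervalIntegrable_rpow' h)

lemma integral_inv_mul_cpow {s : ℂ} (hs : 0 < s.re) :
    ∫ u in Ioc (0 : ℝ) 1, (u : ℂ)⁻¹ * (u : ℂ) ^ s = 1 / s := by
  rw [← Complex.betaIntegral_eval_one_right hs, Complex.betaIntegral,
    intervalIntegral.integral_of_le zero_le_one]
  refine setIntegral_congr_fun measurableSet_Ioc fun u hu => ?_
  have u_ne : (u : ℂ) ≠ 0 := Complex.ofReal_ne_zero.mpr hu.1.ne'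
  simp only [sub_self, Complex.cpow_zero, mul_one]
  rw [Complex.cpow_sub _ _ u_ne, Complex.cpow_one, div_eq_inv_mul]

lemma integrableOn_norm_inv_mul_rpow {r : ℝ} (h0 : 0 < r) :
    IntegrableOn (fun u : ℝ => ‖(u : ℂ)⁻¹‖ * u ^ r) (Ioc 0 1) := by
  refine (integrableOn_rpow_Ioc (show -1 < r - 1 by linarith)).congr ?_
  filter_upwards [ae_restrict_mem measurableSet_Ioc] with u hu
  rw [norm_inv, Complex.norm_real, Real.norm_of_nonneg hu.1.le, Real.rpow_sub_one hu.1.ne',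
    div_eq_inv_mul]

lemma integrable_pi_div_sin_mul_cpow {r : ℝ} (h0 : 0 < r) (h1 : r < 1) {w : ℝ} (hw : 0 < w) :
    Integrable fun t =>
      π / Complex.sin (π * verticalLine r t) * (w : ℂ) ^ verticalLine r t := by
  refine (integrable_pi_div_sin_verticalLine h0 h1).mul_bdd (c := w ^ r)
    (Measurable.aestronglyMeasurable (by fun_prop)) (.of_forall fun t => ?_)
  rw [Complex.norm_cpow_eq_rpow_re_of_pos hw, re_verticalLine]

lemma integrable_pi_div_sin_mul_cpow_div {r : ℝ} (h0 : 0 < r) (h1 : r < 1) {w : ℝ} (hw : 0 < w) :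
    Integrable fun t =>
      π / Complex.sin (π * verticalLine r t) * (w : ℂ) ^ verticalLine r t / verticalLine r t := by
  simpa only [integral_inv_mul_cpow ((re_verticalLine r _).symm ▸ h0), mul_one_div] using
    integrable_mul_integral_mul_cpow (integrable_pi_div_sin_mul_cpow h0 h1 hw)
      (measurable_verticalLine r) (re_verticalLine r) (by fun_prop)
      (integrableOn_norm_inv_mul_rpow h0)

theorem ofReal_log_one_add_eq_integral {r : ℝ} (h0 : 0 < r) (h1 : r < 1) {w : ℝ} (hw : 0 < w) :
    (Real.log (1 + w) : ℂ) = 1 / (2 * (π : ℂ)) * ∫ t : ℝ,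
      π / Complex.sin (π * verticalLine r t) * (w : ℂ) ^ verticalLine r t / verticalLine r t := by
  have swap := integral_mul_integral_mul_cpow_swap (integrable_pi_div_sin_mul_cpow h0 h1 hw)
    (measurable_verticalLine r) (re_verticalLine r) (by fun_prop)
    (integrableOn_norm_inv_mul_rpow h0)
  simp only [integral_inv_mul_cpow ((re_verticalLine r _).symm ▸ h0), mul_one_div] at swap
  rw [← swap, log_one_add_eq_integral_div hw.le, ← integral_complex_ofReal, ← integral_const_mul]
  refine setIntegral_congr_fun measurableSet_Ioc fun u hu => ?_
  have barnes := ofReal_div_one_add_eq_integral h0 h1 (mul_pos hw hu.1)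
  simp only [Complex.ofReal_mul w, Complex.mul_cpow_ofReal_nonneg hw.le hu.1.le, ← mul_assoc]
    at barnes
  rw [mul_left_comm, ← barnes, ← Complex.ofReal_inv, ← Complex.ofReal_mul]
  congr 1
  have := hu.1.ne'
  field_simp

lemma integral_betaWeight_mul_cpow_neg (m : ℕ) {s : ℂ} (hs : s.re < 1) :
    ∫ u in Ioc (0 : ℝ) 1, (betaWeight m u : ℂ) * (u : ℂ) ^ (-s) =
      (m + 1).factorial * (Complex.Gamma (1 - s) / Complex.Gamma (((m + 2 : ℕ) : ℂ) - s)) := by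
  have beta_eq := Complex.betaIntegral_eq_Gamma_mul_div (1 - s) ((m : ℂ) + 1)
    (by simpa using hs) (by simpa using by positivity)
  rw [Complex.Gamma_nat_eq_factorial] at beta_eq
  calc ∫ u in Ioc (0 : ℝ) 1, (betaWeight m u : ℂ) * (u : ℂ) ^ (-s)
      = ((m : ℂ) + 1) * Complex.betaIntegral (1 - s) (m + 1) := by
        rw [Complex.betaIntegral, intervalIntegral.integral_of_le zero_le_one,
          ← integral_const_mul]
        refine setIntegral_congr_fun measurableSet_Ioc fun u _ => ?_
        simp only [betaWeight, add_sub_cancel_right, Complex.cpow_natCast, sub_sub_cancel_left]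
        push_cast
        ring
    _ = _ := by
        rw [beta_eq, show ((m + 2 : ℕ) : ℂ) - s = 1 - s + (m + 1) by push_cast; ring,
          Nat.factorial_succ]
        push_cast
        ring

lemma meijerIntegrand_eq (m : ℕ) {s : ℂ} (hs : 0 < s.re) (z : ℂ) :
    meijerIntegrand [1, 1] [((m + 2 : ℕ) : ℂ)] [1, 1] [0] z s =
      π / Complex.sin (π * s) * z ^ s / s *
        (Complex.Gamma (1 - s) / Complex.Gamma (((m + 2 : ℕ) : ℂ) - s)) := by
  have s_ne : s ≠ 0 := fun h => by simp [h] at hs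
  have Gamma_ne := Complex.Gamma_ne_zero_of_re_pos hs
  rw [← Complex.Gamma_mul_Gamma_one_sub]
  simp only [meijerIntegrand, List.map_cons, List.map_nil, List.prod_cons, List.prod_nil,
    mul_one, sub_self, zero_add, sub_zero]
  rw [add_comm 1 s, Complex.Gamma_add_one s s_ne]
  field_simp

lemma integrableOn_norm_betaWeight_mul_rpow (m : ℕ) {r : ℝ} (h1 : r < 1) :
    IntegrableOn (fun u : ℝ => ‖(betaWeight m u : ℂ)‖ * u ^ (-r)) (Ioc 0 1) := by
  refine (integrableOn_rpow_Ioc (show -1 < -r by linarith)).bdd_mul (c := m + 1)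
    (Continuous.aestronglyMeasurable (by unfold betaWeight; fun_prop)) ?_
  filter_upwards [ae_restrict_mem measurableSet_Ioc] with u hu
  have one_sub_nonneg : 0 ≤ 1 - u := by linarith [hu.2]
  rw [norm_norm, Complex.norm_real, betaWeight, Real.norm_of_nonneg (by positivity)]
  exact mul_le_of_le_one_right (by positivity)
    (pow_le_one₀ one_sub_nonneg (by linarith [hu.1]))

section MeijerG

variable (m : ℕ) {r : ℝ} (h0 : 0 < r) (h1 : r < 1) {z : ℝ} (hz : 0 < z)
include h0 h1 hz

lemma integrable_meijerIntegrand :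
    Integrable fun t : ℝ =>
      meijerIntegrand [1, 1] [((m + 2 : ℕ) : ℂ)] [1, 1] [0] z (verticalLine r t) := by
  have integrable_mul := integrable_mul_integral_mul_cpow
    (integrable_pi_div_sin_mul_cpow_div h0 h1 hz) (κ := fun t => -verticalLine r t) (by fun_prop)
    (ρ := -r) (by simp) (w := fun u => (betaWeight m u : ℂ)) (by unfold betaWeight; fun_prop)
    (integrableOn_norm_betaWeight_mul_rpow m h1)
  have factorial_ne : ((m + 1).factorial : ℂ) ≠ 0 := Nat.cast_ne_zero.mpr (Nat.factorial_ne_zero _)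
  refine (integrable_mul.const_mul ((m + 1).factorial : ℂ)⁻¹).congr (.of_forall fun t => ?_)
  simp only
  rw [integral_betaWeight_mul_cpow_neg m (by simpa using h1),
    meijerIntegrand_eq m (by simpa using h0), mul_left_comm, inv_mul_cancel_left₀ factorial_ne]

lemma integral_meijerIntegrand :
    (m + 1).factorial * ∫ t : ℝ,
        meijerIntegrand [1, 1] [((m + 2 : ℕ) : ℂ)] [1, 1] [0] z (verticalLine r t) =
      ∫ u in Ioc (0 : ℝ) 1, (betaWeight m u : ℂ) * ∫ t : ℝ,
        π / Complex.sin (π * verticalLine r t) * (z : ℂ) ^ verticalLine r t / verticalLine r t *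
          (u : ℂ) ^ (-verticalLine r t) := by
  rw [integral_mul_integral_mul_cpow_swap (integrable_pi_div_sin_mul_cpow_div h0 h1 hz)
    (κ := fun t => -verticalLine r t) (by fun_prop) (ρ := -r) (by simp)
    (by unfold betaWeight; fun_prop) (integrableOn_norm_betaWeight_mul_rpow m h1),
    ← integral_const_mul]
  refine integral_congr_ae (.of_forall fun t => ?_)
  simp only
  rw [integral_betaWeight_mul_cpow_neg m (by simpa using h1),
    meijerIntegrand_eq m (by simpa using h0), mul_left_comm]

theorem factorial_mul_meijerG :
    (m + 1).factorial * meijerG r [1, 1] [((m + 2 : ℕ) : ℂ)] [1, 1] [0] z =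
      ((∫ x in Ioc (0 : ℝ) 1, betaWeight m x * Real.log (1 + z / x) : ℝ) : ℂ) := by
  change (m + 1).factorial * (1 / (2 * (π : ℂ)) * ∫ t : ℝ,
    meijerIntegrand [1, 1] [((m + 2 : ℕ) : ℂ)] [1, 1] [0] z (verticalLine r t)) = _
  rw [mul_left_comm, integral_meijerIntegrand m h0 h1 hz, ← integral_complex_ofReal,
    ← integral_const_mul]
  refine setIntegral_congr_fun measurableSet_Ioc fun u hu => ?_
  rw [Complex.ofReal_mul, ofReal_log_one_add_eq_integral h0 h1 (div_pos hz hu.1), mul_left_comm]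
  congr 3 with t
  rw [div_eq_mul_inv z, Complex.ofReal_mul,
    Complex.mul_cpow_ofReal_nonneg hz.le (inv_nonneg.mpr hu.1.le), Complex.ofReal_inv,
    inv_ofReal_cpow hu.1.le]
  ring

end MeijerG

end MellinBarnes

section GramMatrix

variable {n : ℕ}

lemma measurable_conjugateDiagonal : Measurable (conjugateDiagonal (n := n)) := by
  unfold conjugateDiagonal
  refine Continuous.measurable ?_
  fun_prop

lemma measurable_invDiag (k : Fin n) :
    Measurable fun A : Matrix (Fin n) (Fin n) ℂ => invDiag A k := by
  have measurable_det_inv : Measurable fun A : Matrix (Fin n) (Fin n) ℂ => A.det⁻¹ :=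
    continuous_id.matrix_det.measurable.inv
  have measurable_adjugate : Measurable fun A : Matrix (Fin n) (Fin n) ℂ => A.adjugate k k :=
    (continuous_id.matrix_adjugate.matrix_elem k k).measurable
  simp only [invDiag, Matrix.inv_def, Ring.inverse_eq_inv', Matrix.smul_apply, smul_eq_mul]
  exact Complex.measurable_re.comp (measurable_det_inv.mul measurable_adjugate)

lemma invDiag_pos {Sig : Matrix (Fin n) (Fin n) ℂ} (hSig : Sig.PosDef) (k : Fin n) :
    0 < invDiag Sig k :=
  (Complex.pos_iff.mp hSig.inv.diag_pos).1

lemma conjTranspose_sqrt_mul_sqrt {Sig : Matrix (Fin n) (Fin n) ℂ} (hSig : Sig.PosSemidef) :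
    (CFC.sqrt Sig)ᴴ * CFC.sqrt Sig = Sig := by
  rw [(Matrix.nonneg_iff_posSemidef.mp (CFC.sqrt_nonneg Sig)).isHermitian.eq,
    CFC.sqrt_mul_sqrt_self Sig (Matrix.nonneg_iff_posSemidef.mpr hSig)]

lemma re_conjTranspose_mul_diagonal_mul_apply (c : Fin n → ℝ) (B : Matrix (Fin n) (Fin n) ℂ)
    (k : Fin n) :
    ((Bᴴ * Matrix.diagonal (fun i => (c i : ℂ)) * B) k k).re = weightedNormSq c fun i => B i k := by
  rw [Matrix.mul_apply, Complex.re_sum, weightedNormSq]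
  refine Finset.sum_congr rfl fun i _ => ?_
  rw [Matrix.mul_diagonal, Matrix.conjTranspose_apply, Complex.star_def, mul_right_comm,
    Complex.conj_mul', mul_comm]
  norm_cast

lemma invDiag_conjTranspose_mul_conjugateDiagonal_mul (S : Matrix (Fin n) (Fin n) ℂ) (k : Fin n)
    (U : Matrix.unitaryGroup (Fin n) ℂ) {lam : Fin n → ℝ} (hl : ∀ i, lam i ≠ 0) :
    invDiag (Sᴴ * conjugateDiagonal (U, lam) * S) k =
      weightedNormSq (fun i => (lam i)⁻¹)
        ((U : Matrix (Fin n) (Fin n) ℂ) *ᵥ (S⁻¹ᴴ).col k) := by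
  have inv_diagonal : (Matrix.diagonal fun i => (lam i : ℂ))⁻¹ =
      Matrix.diagonal fun i => (((lam i)⁻¹ : ℝ) : ℂ) := by
    refine Matrix.inv_eq_right_inv ?_
    simp [Matrix.diagonal_mul_diagonal, hl]
  have inv_unitary : (U : Matrix (Fin n) (Fin n) ℂ)⁻¹ = (U : Matrix (Fin n) (Fin n) ℂ)ᴴ :=
    Matrix.inv_eq_left_inv (Matrix.mem_unitaryGroup_iff'.mp U.2)
  have inv_conjTranspose_unitary :
      ((U : Matrix (Fin n) (Fin n) ℂ)ᴴ)⁻¹ = (U : Matrix (Fin n) (Fin n) ℂ) :=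
    Matrix.inv_eq_left_inv (Matrix.mem_unitaryGroup_iff.mp U.2)
  convert re_conjTranspose_mul_diagonal_mul_apply (fun i => (lam i)⁻¹)
    ((U : Matrix (Fin n) (Fin n) ℂ) * S⁻¹ᴴ) k using 1
  swap; · rfl
  simp only [invDiag, conjugateDiagonal, Matrix.mul_inv_rev, inv_diagonal, inv_unitary,
    inv_conjTranspose_unitary, Matrix.conjTranspose_mul, Matrix.conjTranspose_conjTranspose,
    Matrix.conjTranspose_nonsing_inv, Matrix.mul_assoc]

lemma invDiag_conjTranspose_mul_self (S : Matrix (Fin n) (Fin n) ℂ) (k : Fin n) :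
    invDiag (Sᴴ * S) k = ‖WithLp.toLp 2 ((S⁻¹ᴴ).col k)‖ ^ 2 := by
  simpa [conjugateDiagonal, ← Pi.one_def, weightedNormSq, EuclideanSpace.norm_sq_eq] using
    invDiag_conjTranspose_mul_conjugateDiagonal_mul S k 1 (lam := 1) (by simp)

/-- The zero-forcing SINR of the channel `P * S`, as a function of the Gram matrix `Pᴴ * P`. -/
noncomputable def gramSINR (δ : ℝ) (S : Matrix (Fin n) (Fin n) ℂ) (k : Fin n)
    (A : Matrix (Fin n) (Fin n) ℂ) : ℝ :=
  δ / invDiag (Sᴴ * A * S) k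

lemma zfSINR_mul {l : ℕ} (δ : ℝ) (P : Matrix (Fin l) (Fin n) ℂ) (S : Matrix (Fin n) (Fin n) ℂ)
    (k : Fin n) : zfSINR δ (P * S) k = gramSINR δ S k (Pᴴ * P) := by
  simp only [zfSINR, gramSINR, invDiag, Matrix.conjTranspose_mul, Matrix.mul_assoc]

lemma measurable_gramSINR (δ : ℝ) (S : Matrix (Fin n) (Fin n) ℂ) (k : Fin n) :
    Measurable (gramSINR δ S k) :=
  measurable_const.div ((measurable_invDiag k).comp
    (Continuous.measurable (by fun_prop : Continuous fun A => Sᴴ * A * S)))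

lemma measurable_gramSINR_conjugateDiagonal (δ : ℝ) (S : Matrix (Fin n) (Fin n) ℂ) (k : Fin n) :
    Measurable fun z => gramSINR δ S k (conjugateDiagonal z) :=
  (measurable_gramSINR δ S k).comp measurable_conjugateDiagonal

variable {S : Matrix (Fin n) (Fin n) ℂ} {k : Fin n} (hS : 0 < invDiag (Sᴴ * S) k)
  {lam : Fin n → ℝ} (hl : ∀ i, 0 < lam i) {δ : ℝ} (hδ : 0 < δ)

include hS

lemma col_conjTranspose_inv_ne_zero : (S⁻¹ᴴ).col k ≠ 0 := by
  rw [invDiag_conjTranspose_mul_self] at hS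
  rintro h
  simp [h] at hS

include hl

lemma weightedNormSq_inv_unitary_mulVec_pos (U : Matrix.unitaryGroup (Fin n) ℂ) :
    0 < weightedNormSq (fun i => (lam i)⁻¹)
      ((U : Matrix (Fin n) (Fin n) ℂ) *ᵥ (S⁻¹ᴴ).col k) :=
  weightedNormSq_pos (fun i => inv_pos.mpr (hl i))
    (unitary_mulVec_ne_zero U (col_conjTranspose_inv_ne_zero hS))

include hδ

lemma gramSINR_conjugateDiagonal_pos (U : Matrix.unitaryGroup (Fin n) ℂ) :
    0 < gramSINR δ S k (conjugateDiagonal (U, lam)) := by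
  rw [gramSINR, invDiag_conjTranspose_mul_conjugateDiagonal_mul S k U fun i => (hl i).ne']
  exact div_pos hδ (weightedNormSq_inv_unitary_mulVec_pos hS hl U)

lemma gramSINR_div_gramSINR_add (s : ℝ) (U : Matrix.unitaryGroup (Fin n) ℂ) :
    gramSINR δ S k (conjugateDiagonal (U, lam)) /
        (gramSINR δ S k (conjugateDiagonal (U, lam)) + s) =
      ‖WithLp.toLp 2 ((S⁻¹ᴴ).col k)‖ ^ 2 /
        weightedNormSq (fun i => 1 + invDiag (Sᴴ * S) k / δ * s * (lam i)⁻¹)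
          ((U : Matrix (Fin n) (Fin n) ℂ) *ᵥ (S⁻¹ᴴ).col k) := by
  have form_pos := weightedNormSq_inv_unitary_mulVec_pos hS hl U
  rw [gramSINR, invDiag_conjTranspose_mul_conjugateDiagonal_mul S k U fun i => (hl i).ne',
    weightedNormSq_const_add_mul, one_mul, norm_unitary_mulVec, ← invDiag_conjTranspose_mul_self]
  generalize weightedNormSq (ι := Fin n) _ _ = form at form_pos
  field_simp

theorem integral_haarUnitary_gramSINR_div_add_pow {s : ℝ} (hs : 0 < s) :
    ∫ U, (gramSINR δ S k (conjugateDiagonal (U, lam)) /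
        (gramSINR δ S k (conjugateDiagonal (U, lam)) + s)) ^ n ∂haarUnitary n =
      ∏ i, lam i / (lam i + invDiag (Sᴴ * S) k / δ * s) := by
  simp_rw [gramSINR_div_gramSINR_add hS hl hδ]
  rw [integral_haarUnitary_norm_sq_div_weightedNormSq_pow (col_conjTranspose_inv_ne_zero hS)]
  · refine Finset.prod_congr rfl fun i _ => ?_
    have := hl i
    field_simp
  · intro i
    have := hl i
    positivity

end GramMatrix

namespace IsBiorthonormalSystem

variable {n : ℕ} {p : Fin n → Polynomial ℝ} {q : Fin n → ℝ → ℝ}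

lemma integrable_pow_mul_polyKernel {ν : Measure ℝ} (h : IsBiorthonormalSystem ν p q)
    (a : Fin n) (x : ℝ) : Integrable (fun y => y ^ (a : ℕ) * polyKernel p q x y) ν := by
  simp only [polyKernel, Finset.mul_sum]
  refine integrable_finsetSum _ fun j _ => ?_
  simpa only [mul_left_comm] using (h.integrable_pow_mul a j).const_mul ((p j).eval x)

lemma aemeasurable_eigenvalueDensity
    (h : IsBiorthonormalSystem (volume.restrict (Ioi 0)) p q) :
    AEMeasurable (eigenvalueDensity q) (volume.restrict (positiveOrthant n)) := by
  have aemeasurable_weight (a b : Fin n) :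
      AEMeasurable (fun lam : Fin n → ℝ => q b (lam a))
        (Measure.pi fun _ => volume.restrict (Ioi (0 : ℝ))) := by
    have hq := (h.integrable_pow_mul ⟨0, a.pos⟩ b).aemeasurable
    simp only [pow_zero, one_mul] at hq
    exact hq.comp_quasiMeasurePreserving (Measure.quasiMeasurePreserving_eval _ a)
  rw [restrict_positiveOrthant]
  unfold eigenvalueDensity
  refine AEMeasurable.mul (Measurable.aemeasurable (by fun_prop)) ?_
  simp only [Matrix.det_apply', Matrix.of_apply]
  exact Finset.aemeasurable_fun_sum _ fun σ _ =>
    (Finset.aemeasurable_fun_prod _ fun i _ => aemeasurable_weight _ _).const_mul _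

end IsBiorthonormalSystem

section EigenvalueLaw

variable {n : ℕ} (q : Fin n → ℝ → ℝ)

instance sFinite_eigenvalueLaw : SFinite (eigenvalueLaw q) := by
  unfold eigenvalueLaw
  infer_instance

lemma ae_eigenvalueLaw_pos : ∀ᵐ lam ∂(eigenvalueLaw q), ∀ i, 0 < lam i := by
  refine (withDensity_absolutelyContinuous _ _).ae_le (ae_restrict_mem ?_)
  unfold positiveOrthant
  measurability

lemma ae_prod_eigenvalueLaw_pos :
    ∀ᵐ z ∂(haarUnitary n).prod (eigenvalueLaw q), ∀ i, 0 < z.2 i :=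
  Measure.quasiMeasurePreserving_snd.ae (ae_eigenvalueLaw_pos q)

end EigenvalueLaw

namespace IsInvariantPolynomialEnsemble

variable {Ω : Type*} [MeasurableSpace Ω] {μ : Measure Ω} {l n : ℕ}
  {P : Ω → Matrix (Fin l) (Fin n) ℂ} {p : Fin n → Polynomial ℝ} {q : Fin n → ℝ → ℝ}

lemma isBiorthonormalSystem (hP : IsInvariantPolynomialEnsemble μ P p q) :
    IsBiorthonormalSystem (volume.restrict (Ioi 0)) p q :=
  ⟨hP.monic, hP.natDegree_eq, hP.integrable, hP.biorthonormal⟩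

lemma integral_eigenvalueLaw (hP : IsInvariantPolynomialEnsemble μ P p q)
    (f : (Fin n → ℝ) → ℝ) :
    ∫ lam, f lam ∂eigenvalueLaw q =
      ∫ lam in positiveOrthant n, eigenvalueDensity q lam * f lam := by
  rw [eigenvalueLaw,
    integral_withDensity_ofReal hP.isBiorthonormalSystem.aemeasurable_eigenvalueDensity]
  refine integral_congr_ae ?_
  filter_upwards [hP.density_nonneg] with lam hlam
  rw [max_eq_left hlam]

lemma aemeasurable_gram (hP : IsInvariantPolynomialEnsemble μ P p q) :
    AEMeasurable (fun ω => (P ω)ᴴ * P ω) μ :=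
  (Continuous.measurable (by fun_prop :
    Continuous fun A : Matrix (Fin l) (Fin n) ℂ => Aᴴ * A)).comp_aemeasurable hP.aemeasurable

lemma isProbabilityMeasure_eigenvalueLaw [IsProbabilityMeasure μ]
    (hP : IsInvariantPolynomialEnsemble μ P p q) : IsProbabilityMeasure (eigenvalueLaw q) := by
  have : IsProbabilityMeasure
      (((haarUnitary n).prod (eigenvalueLaw q)).map conjugateDiagonal) :=
    hP.law ▸ Measure.isProbabilityMeasure_map hP.aemeasurable_gram
  have := Measure.isProbabilityMeasure_of_map (μ := (haarUnitary n).prod (eigenvalueLaw q))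
    conjugateDiagonal
  rw [← Measure.snd_prod (μ := haarUnitary n) (ν := eigenvalueLaw q)]
  infer_instance

variable {S : Matrix (Fin n) (Fin n) ℂ} {k : Fin n} {δ : ℝ}

lemma aemeasurable_zfSINR (hP : IsInvariantPolynomialEnsemble μ P p q) :
    AEMeasurable (fun ω => zfSINR δ (P ω * S) k) μ := by
  simp only [zfSINR_mul]
  exact (measurable_gramSINR δ S k).comp_aemeasurable hP.aemeasurable_gram

lemma map_zfSINR (hP : IsInvariantPolynomialEnsemble μ P p q) :
    μ.map (fun ω => zfSINR δ (P ω * S) k) =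
      ((haarUnitary n).prod (eigenvalueLaw q)).map
        fun z => gramSINR δ S k (conjugateDiagonal z) := by
  simp only [zfSINR_mul]
  have map_gram := AEMeasurable.map_map_of_aemeasurable
    (measurable_gramSINR δ S k).aemeasurable hP.aemeasurable_gram
  rw [hP.law, Measure.map_map (measurable_gramSINR δ S k) measurable_conjugateDiagonal] at map_gram
  exact map_gram.symm

section Law

variable (hP : IsInvariantPolynomialEnsemble μ P p q) (hS : 0 < invDiag (Sᴴ * S) k) (hδ : 0 < δ)

include hP hS hδ

lemma ae_map_zfSINR_pos : ∀ᵐ x ∂(μ.map fun ω => zfSINR δ (P ω * S) k), 0 < x := by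
  rw [hP.map_zfSINR, ae_map_iff (measurable_gramSINR_conjugateDiagonal δ S k).aemeasurable
    measurableSet_Ioi]
  filter_upwards [ae_prod_eigenvalueLaw_pos q] with z hz
  exact gramSINR_conjugateDiagonal_pos hS hz hδ z.1

theorem integral_map_zfSINR_div_add_pow [IsProbabilityMeasure μ] {s : ℝ} (hs : 0 < s) :
    ∫ x, (x / (x + s)) ^ n ∂(μ.map fun ω => zfSINR δ (P ω * S) k) =
      ∫ y in Ioi (0 : ℝ), polyKernel p q 0 y * (y / (y + invDiag (Sᴴ * S) k / δ * s)) := by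
  have := hP.isProbabilityMeasure_eigenvalueLaw
  have integrable_resolvent : Integrable
      (fun z => (gramSINR δ S k (conjugateDiagonal z) /
        (gramSINR δ S k (conjugateDiagonal z) + s)) ^ n)
      ((haarUnitary n).prod (eigenvalueLaw q)) := by
    refine .of_bound (Measurable.aestronglyMeasurable ?_) 1 ?_
    · exact (show Measurable fun x : ℝ => (x / (x + s)) ^ n by fun_prop).comp
        (measurable_gramSINR_conjugateDiagonal δ S k)
    · filter_upwards [ae_prod_eigenvalueLaw_pos q] with z hz
      have gram_pos := gramSINR_conjugateDiagonal_pos hS hz hδ z.1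
      rw [Real.norm_of_nonneg (by positivity)]
      exact pow_le_one₀ (by positivity) (div_le_one_of_le₀ (by linarith) (by positivity))
  calc ∫ x, (x / (x + s)) ^ n ∂(μ.map fun ω => zfSINR δ (P ω * S) k)
      = ∫ z, (gramSINR δ S k (conjugateDiagonal z) /
          (gramSINR δ S k (conjugateDiagonal z) + s)) ^ n
          ∂(haarUnitary n).prod (eigenvalueLaw q) := by
        rw [hP.map_zfSINR, integral_map (measurable_gramSINR_conjugateDiagonal δ S k).aemeasurable
          (Measurable.aestronglyMeasurable (by fun_prop))]
    _ = ∫ lam, ∏ i, lam i / (lam i + invDiag (Sᴴ * S) k / δ * s) ∂eigenvalueLaw q := by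
        rw [integral_prod_symm _ integrable_resolvent]
        refine integral_congr_ae ?_
        filter_upwards [ae_eigenvalueLaw_pos q] with lam hl
        exact integral_haarUnitary_gramSINR_div_add_pow hS hl hδ hs
    _ = ∫ y in Ioi (0 : ℝ), polyKernel p q 0 y * (y / (y + invDiag (Sᴴ * S) k / δ * s)) := by
        rw [hP.integral_eigenvalueLaw]
        cases n with
        | zero => exact k.elim0
        | succ m =>
          exact hP.isBiorthonormalSystem.integral_eigenvalueDensity_mul_prod_div_add
            (by positivity)

end Law

end IsInvariantPolynomialEnsemble

lemma nonneg_of_ae_nonneg_of_continuousOn {X : Type*} [TopologicalSpace X] [MeasurableSpace X]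
    {ν : Measure X} [ν.IsOpenPosMeasure] {U : Set X} (hU : IsOpen U) {f : X → ℝ}
    (hf : ContinuousOn f U) (h : ∀ᵐ x ∂ν.restrict U, 0 ≤ f x) {x : X} (hx : x ∈ U) :
    0 ≤ f x := by
  have abs_ae_eq : (fun y => |f y|) =ᵐ[ν.restrict U] f := by
    filter_upwards [h] with y hy using abs_of_nonneg hy
  exact (Measure.eqOn_open_of_ae_eq abs_ae_eq hU hf.abs hf hx) ▸ abs_nonneg (f x)

section MeijerSum

variable {m : ℕ} {ι : Type*} [Fintype ι]

lemma mul_sum_meijerG {r : ℝ} (h0 : 0 < r) (h1 : r < 1) {z : ι → ℝ} (hz : ∀ k, 0 < z k)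
    (a : ℝ) :
    (a : ℂ) * ∑ k, meijerG r [1, 1] [((m + 2 : ℕ) : ℂ)] [1, 1] [0] (z k) =
      ((m + 1).factorial : ℂ)⁻¹ *
        ((∑ k, a * ∫ x in Ioc (0 : ℝ) 1, betaWeight m x * Real.log (1 + z k / x) : ℝ) : ℂ) := by
  have factorial_ne_zero : ((m + 1).factorial : ℂ) ≠ 0 :=
    Nat.cast_ne_zero.mpr (Nat.factorial_ne_zero _)
  simp only [Complex.ofReal_sum, Complex.ofReal_mul, ← factorial_mul_meijerG m h0 h1 (hz _),
    Finset.mul_sum, mul_left_comm (a : ℂ), inv_mul_cancel_left₀ factorial_ne_zero]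

variable {K : ℝ → ℝ → ℝ} (hK : IntegrableOn (K 0) (Ioi 0))
  (hK₁ : IntegrableOn (fun y => y * K 0 y) (Ioi 0)) {σ : ι → ℝ} (hσ : ∀ k, 0 < σ k) {δ : ℝ}
  (hδ : 0 < δ) {r : ℝ} (h0 : 0 < r) (h1 : r < 1)

include hK hK₁ hσ hδ

lemma integrableOn_sum_mul_integral_betaWeight_mul_log :
    IntegrableOn (fun y => ∑ k, K 0 y *
      ∫ x in Ioc (0 : ℝ) 1, betaWeight m x * Real.log (1 + δ / σ k * y / x)) (Ioi 0) :=
  integrable_finsetSum _ fun k _ => integrableOn_mul_integral_betaWeight_mul_log hK hK₁ (hσ k) hδ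

include h0 h1

lemma integrableOn_mul_sum_meijerG :
    IntegrableOn (fun y => (K 0 y : ℂ) * ∑ k, meijerG r [1, 1] [((m + 2 : ℕ) : ℂ)] [1, 1] [0]
      ((δ / σ k * y : ℝ) : ℂ)) (Ioi 0) := by
  have hsum := integrableOn_sum_mul_integral_betaWeight_mul_log (m := m) hK hK₁ hσ hδ
  refine (hsum.ofReal (𝕜 := ℂ).const_mul ((m + 1).factorial : ℂ)⁻¹).congr ?_
  filter_upwards [ae_restrict_mem measurableSet_Ioi] with y hy
  exact (mul_sum_meijerG h0 h1 (fun k => mul_pos (div_pos hδ (hσ k)) hy) (K 0 y)).symm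

theorem factorial_mul_integral_mul_sum_meijerG :
    ((m + 1).factorial : ℂ) * ∫ y in Ioi (0 : ℝ), (K 0 y : ℂ) *
        ∑ k, meijerG r [1, 1] [((m + 2 : ℕ) : ℂ)] [1, 1] [0] ((δ / σ k * y : ℝ) : ℂ) =
      ((∑ k, ∫ γ in Ioi (0 : ℝ), zfDensity (m + 2) K (σ k) δ γ * Real.log (1 + γ) : ℝ) : ℂ) := by
  have factorial_ne_zero : ((m + 1).factorial : ℂ) ≠ 0 :=
    Nat.cast_ne_zero.mpr (Nat.factorial_ne_zero _)
  rw [setIntegral_congr_fun measurableSet_Ioi fun y hy =>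
      mul_sum_meijerG h0 h1 (fun k => mul_pos (div_pos hδ (hσ k)) hy) (K 0 y),
    integral_const_mul, mul_inv_cancel_left₀ factorial_ne_zero, integral_complex_ofReal,
    integral_finsetSum _ fun k _ => integrableOn_mul_integral_betaWeight_mul_log hK hK₁ (hσ k) hδ]
  simp only [integral_zfDensity_mul_log hK hK₁ (hσ _) hδ]

end MeijerSum

namespace IsInvariantPolynomialEnsemble

variable {Ω : Type*} [MeasurableSpace Ω] {μ : Measure Ω} {l m : ℕ}
  {P : Ω → Matrix (Fin l) (Fin (m + 2)) ℂ} {p : Fin (m + 2) → Polynomial ℝ}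
  {q : Fin (m + 2) → ℝ → ℝ} (hP : IsInvariantPolynomialEnsemble μ P p q)

include hP

lemma integrableOn_polyKernel : IntegrableOn (polyKernel p q 0) (Ioi 0) := by
  simpa [IntegrableOn] using hP.isBiorthonormalSystem.integrable_pow_mul_polyKernel 0 0

lemma integrableOn_mul_polyKernel :
    IntegrableOn (fun y => y * polyKernel p q 0 y) (Ioi 0) := by
  simpa [IntegrableOn] using hP.isBiorthonormalSystem.integrable_pow_mul_polyKernel 1 0

variable [IsProbabilityMeasure μ] {S : Matrix (Fin (m + 2)) (Fin (m + 2)) ℂ} {k : Fin (m + 2)}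
  (hS : 0 < invDiag (Sᴴ * S) k) {δ : ℝ} (hδ : 0 < δ)

include hS hδ

lemma ae_zfDensity_nonneg_and_map_zfSINR_eq :
    (∀ᵐ γ ∂volume.restrict (Ioi 0),
      0 ≤ zfDensity (m + 2) (polyKernel p q) (invDiag (Sᴴ * S) k) δ γ) ∧
    μ.map (fun ω => zfSINR δ (P ω * S) k) = (volume.restrict (Ioi 0)).withDensity fun γ =>
      ENNReal.ofReal (zfDensity (m + 2) (polyKernel p q) (invDiag (Sᴴ * S) k) δ γ) := by
  have : IsProbabilityMeasure (μ.map fun ω => zfSINR δ (P ω * S) k) :=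
    Measure.isProbabilityMeasure_map hP.aemeasurable_zfSINR
  have ae_pos : ∀ᵐ γ ∂volume.restrict (Ioi (0 : ℝ)), 0 < γ := ae_restrict_mem measurableSet_Ioi
  refine eq_withDensity_of_integral_div_add_pow ae_pos
    (hP.ae_map_zfSINR_pos hS hδ) (integrableOn_zfDensity hP.integrableOn_polyKernel hS hδ)
    (Nat.succ_ne_zero (m + 1)) fun s hs => ?_
  rw [hP.integral_map_zfSINR_div_add_pow hS hδ hs,
    integral_zfDensity_mul_div_add_pow hP.integrableOn_polyKernel hS hδ hs]

theorem map_zfSINR_eq_withDensity :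
    μ.map (fun ω => zfSINR δ (P ω * S) k) = (volume.restrict (Ioi 0)).withDensity fun γ =>
      ENNReal.ofReal (zfDensity (m + 2) (polyKernel p q) (invDiag (Sᴴ * S) k) δ γ) :=
  (hP.ae_zfDensity_nonneg_and_map_zfSINR_eq hS hδ).2

theorem zfDensity_nonneg {γ : ℝ} (hγ : 0 < γ) :
    0 ≤ zfDensity (m + 2) (polyKernel p q) (invDiag (Sᴴ * S) k) δ γ :=
  nonneg_of_ae_nonneg_of_continuousOn isOpen_Ioi
    (continuousOn_zfDensity hP.integrableOn_polyKernel hS hδ)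
    (hP.ae_zfDensity_nonneg_and_map_zfSINR_eq hS hδ).1 hγ

theorem integrable_log_zfSINR :
    Integrable (fun ω => Real.log (1 + zfSINR δ (P ω * S) k)) μ := by
  have hlog := integrableOn_zfDensity_mul_log (m := m) hP.integrableOn_polyKernel
    hP.integrableOn_mul_polyKernel hS hδ
  refine (integrable_map_measure (f := fun ω => zfSINR δ (P ω * S) k)
    (g := fun x => Real.log (1 + x)) (Measurable.aestronglyMeasurable (by fun_prop))
    hP.aemeasurable_zfSINR).mp ?_
  rw [hP.map_zfSINR_eq_withDensity hS hδ, integrable_withDensity_iff_integrable_smul₀'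
    (integrableOn_zfDensity hP.integrableOn_polyKernel hS hδ).aemeasurable.ennreal_ofReal
    (.of_forall fun _ => ENNReal.ofReal_lt_top)]
  refine hlog.congr_fun (fun γ hγ => ?_) measurableSet_Ioi
  rw [ENNReal.toReal_ofReal (hP.zfDensity_nonneg hS hδ hγ), smul_eq_mul]

theorem integral_log_zfSINR :
    ∫ ω, Real.log (1 + zfSINR δ (P ω * S) k) ∂μ =
      ∫ γ in Ioi (0 : ℝ), zfDensity (m + 2) (polyKernel p q) (invDiag (Sᴴ * S) k) δ γ *
        Real.log (1 + γ) := by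
  rw [← integral_map (f := fun x => Real.log (1 + x)) hP.aemeasurable_zfSINR
      (Measurable.aestronglyMeasurable (by fun_prop)),
    hP.map_zfSINR_eq_withDensity hS hδ, integral_withDensity_ofReal
      (integrableOn_zfDensity hP.integrableOn_polyKernel hS hδ).aemeasurable]
  refine setIntegral_congr_fun measurableSet_Ioi fun γ hγ => ?_
  simp only [max_eq_left (hP.zfDensity_nonneg hS hδ hγ)]

end IsInvariantPolynomialEnsemble

theorem proposition1 {Ω : Type*} [MeasurableSpace Ω] (μ : Measure Ω) [IsProbabilityMeasure μ]
    (nr nt : ℕ) (hnt : 2 ≤ nt) (hnr : nt ≤ nr)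
    (P : Ω → Matrix (Fin nr) (Fin nt) ℂ)
    (p : Fin nt → Polynomial ℝ) (q : Fin nt → ℝ → ℝ)
    (hP : IsInvariantPolynomialEnsemble μ P p q)
    (Sigt : Matrix (Fin nt) (Fin nt) ℂ) (hSigt : Sigt.PosDef)
    (H : Ω → Matrix (Fin nr) (Fin nt) ℂ) (hH : ∀ ω, H ω = P ω * CFC.sqrt Sigt)
    (δ : ℝ) (hδ : 0 < δ) :
    (∀ k : Fin nt,
      (∀ γ : ℝ, 0 < γ →
        IntervalIntegrable
          (fun x => polyKernel p q 0 (invDiag Sigt k * γ * x / δ) * (1 - x) ^ (nt - 2) * x)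
          volume 0 1 ∧
        0 ≤ zfDensity nt (polyKernel p q) (invDiag Sigt k) δ γ) ∧
      AEMeasurable (fun ω => zfSINR δ (H ω) k) μ ∧
      μ.map (fun ω => zfSINR δ (H ω) k) =
        (volume.restrict (Ioi 0)).withDensity
          (fun γ => ENNReal.ofReal (zfDensity nt (polyKernel p q) (invDiag Sigt k) δ γ)) ∧
      Integrable (fun ω => Real.log (1 + zfSINR δ (H ω) k)) μ) ∧
    (∀ r : ℝ, IsMeijerAbscissa [1, 1] [1, 1] r →
      (∀ x : ℝ, 0 < x → ∀ k : Fin nt, Integrable (fun t : ℝ =>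
        meijerIntegrand [1, 1] [(nt : ℂ)] [1, 1] [0] ((δ / invDiag Sigt k * x : ℝ) : ℂ)
          ((r : ℂ) + (t : ℂ) * Complex.I))) ∧
      IntegrableOn (fun x : ℝ => (polyKernel p q 0 x : ℂ) *
        ∑ k : Fin nt, meijerG r [1, 1] [(nt : ℂ)] [1, 1] [0]
          ((δ / invDiag Sigt k * x : ℝ) : ℂ)) (Ioi 0) ∧
      ((sumRate μ (fun k ω => zfSINR δ (H ω) k) : ℝ) : ℂ) =
        ((nt - 1).factorial : ℂ) * ∫ x in Ioi (0 : ℝ), (polyKernel p q 0 x : ℂ) *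
          ∑ k : Fin nt, meijerG r [1, 1] [(nt : ℂ)] [1, 1] [0]
            ((δ / invDiag Sigt k * x : ℝ) : ℂ)) := by
  obtain ⟨m, rfl⟩ := Nat.exists_eq_add_of_le' hnt
  obtain rfl : H = fun ω => P ω * CFC.sqrt Sigt := funext hH
  have hσ := invDiag_pos hSigt
  have hS := conjTranspose_sqrt_mul_sqrt hSigt.posSemidef
  generalize CFC.sqrt Sigt = S at hS ⊢
  subst hS
  have hK := hP.integrableOn_polyKernel
  have hK₁ := hP.integrableOn_mul_polyKernel
  refine ⟨fun k => ⟨fun γ hγ => ⟨intervalIntegrable_zfDensity_integrand hK (hσ k) hδ hγ,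
      hP.zfDensity_nonneg (hσ k) hδ hγ⟩, hP.aemeasurable_zfSINR,
      hP.map_zfSINR_eq_withDensity (hσ k) hδ, hP.integrable_log_zfSINR (hσ k) hδ⟩,
    fun r hr => ?_⟩
  have h1 : r < 1 := by simpa using hr.1 1 (by simp)
  have h0 : 0 < r := by simpa using hr.2 1 (by simp)
  refine ⟨fun x hx k => integrable_meijerIntegrand m h0 h1 (mul_pos (div_pos hδ (hσ k)) hx),
    integrableOn_mul_sum_meijerG hK hK₁ hσ hδ h0 h1, ?_⟩
  simp only [sumRate, hP.integral_log_zfSINR (hσ _) hδ]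
  exact (factorial_mul_integral_mul_sum_meijerG hK hK₁ hσ hδ h0 h1).symm
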